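/- Let $n\ge 2$ and let $\mathbb{H}^{n+1}=\{p\in\mathbb{L}^{n+2}:\langle p,p\rangle=-1,\ p_0>0\}$ in Minkowski space $(\mathbb{L}^{n+2},\ \langle\,,\rangle=-dx_0^2+\sum_{i=1}^{n+1}dx_i^2)$. A compact smoothly immersed hypersurface $\phi$ of $\mathbb{H}^{n+1}$ is a *horospherical ovaloid* if it has a unit normal field $\eta$ for which it is horospherically convex at every point $p$, that is: near $p$ it meets the horosphere tangent at $p$ with interior unit normal $\eta(p)$ only in $p$, and its distance to this horosphere does not vanish up to second order at $p$ in any direction. It is *canonically oriented* by $\eta$ if all its principal curvatures (the eigenvalues of $II=-\langle d\phi,d\eta\rangle$ with respect to $I=\langle d\phi,d\phi\rangle$) are everywhere $<1$. The *hyperbolic curvature radii* are $\mathcal{R}_i=1/|1-\kappa_i|$, where $\kappa_1,\dots,\kappa_n$ are the principal curvatures. Write $\psi=\phi+\eta=e^{\rho}(1,G)$, where $G$, with values in $\mathbb{S}^n$, is the hyperbolic Gauss map; the *horospherical metric* is $g=e^{2\rho}\,G^*g_0$, with $g_0$ the round metric of $\mathbb{S}^n$. Its *Schouten tensor* is $$\mathrm{Sch}_g=\frac{1}{n-2}\Big(\mathrm{Ric}_g-\frac{S(g)}{2(n-1)}\,g\Big)\quad\text{if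 } n>2,$$ $$\mathrm{Sch}_g=-\nabla^{2,h}\rho+d\rho\otimes d\rho-\tfrac12\big(-1+\|\nabla^{h}\rho\|_h^2\big)h,\quad h=G^*g_0,\quad\text{if } n=2,$$ where $\mathrm{Ric}_g$ and $S(g)$ are the Ricci tensor and the scalar curvature of $g$. **Corollary.** Let $\phi:\mathbb{S}^n\to\mathbb{H}^{n+1}$ be a canonically oriented horospherical ovaloid with horospherical metric $g$, and let $x\in\mathbb{S}^n$. Let $\kappa_1,\dots,\kappa_n$ be the principal curvatures of $\phi$ at $x$, and let $\lambda_1,\dots,\lambda_n$ be the eigenvalues of $\mathrm{Sch}_g$ with respect to $g$ at $x$, both counted with multiplicity (both families exist). Then, in a suitable order, $$\mathcal{R}_i=\frac{1}{1-\kappa_i}=\frac12-\lambda_i,\qquad\text{equivalently}\qquad 2\lambda_i=\frac{\kappa_i+1}{\kappa_i-1},\qquad i=1,\dots,n.$$ Moreover, the eigendirections of $\mathrm{Sch}_g$ at $x$ coincide with the principal directions of $\phi$ at $x$, and along each common direction the principal curvature and the eigenvalue of $\mathrm{Sch}_g$ are related by the same formulas. -/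

import Mathlib

open scoped Manifold ContDiff Topology

noncomputable section

/-! ### Minkowski space, hyperbolic space, horospheres -/

/-- The vector space underlying Minkowski space `𝕃^{n+2}`; a point is `(x₀, (x₁, …, x_{n+1}))`. -/
abbrev MinkowskiSpace (n : ℕ) : Type := ℝ × EuclideanSpace ℝ (Fin (n + 1))

/-- The Lorentzian metric `-dx₀² + dx₁² + ⋯ + dx_{n+1}²`. -/
def lorentz {n : ℕ} (p q : MinkowskiSpace n) : ℝ :=
  -(p.1 * q.1) + inner ℝ p.2 q.2

/-- Hyperbolic space `ℍ^{n+1}` as the upper sheet of the hyperboloid in `𝕃^{n+2}`. -/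
def hyperbolicSpace (n : ℕ) : Set (MinkowskiSpace n) :=
  {p | lorentz p p = -1 ∧ 0 < p.1}

/-- The geodesic distance of `ℍ^{n+1}`. -/
def hyperbolicDist {n : ℕ} (p q : MinkowskiSpace n) : ℝ :=
  Real.arcosh (-lorentz p q)

/-- The horosphere of `ℍ^{n+1}` given by a vector `v = e^ρ (1, x)`, `‖x‖ = 1`, of the positive light
cone. Its point at infinity
is `x`, and its interior unit normal at a point `p` of it is `v - p`. -/
def horosphere {n : ℕ} (v : MinkowskiSpace n) : Set (MinkowskiSpace n) :=
  {p | p ∈ hyperbolicSpace n ∧ lorentz p v = -1}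

/-- The distance in `ℍ^{n+1}` of a point to a horosphere. -/
def distToHorosphere {n : ℕ} (p v : MinkowskiSpace n) : ℝ :=
  sInf (hyperbolicDist p '' horosphere v)

/-! ### Immersed oriented hypersurfaces of hyperbolic space

`M` is an `n`-dimensional manifold. For a map `f` into a vector space, `mvfderiv (𝓡 n) f x` is its
differential at `x`. -/

/-- `φ : M → ℍ^{n+1}` is a smooth immersed hypersurface. -/
structure IsImmersedHypersurface {n : ℕ} {M : Type*} [TopologicalSpace M]
    [ChartedSpace (EuclideanSpace ℝ (Fin n)) M] (φ : M → MinkowskiSpace n) : Prop where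
  smooth : ContMDiff (𝓡 n) 𝓘(ℝ, MinkowskiSpace n) ∞ φ
  mem_hyperbolicSpace : ∀ x, φ x ∈ hyperbolicSpace n
  immersion : ∀ x, Function.Injective (mvfderiv (𝓡 n) φ x)

/-- `η` is a smooth unit normal field (that is, an orientation) of the hypersurface `φ` in
`ℍ^{n+1}`: it is unit spacelike, tangent to `ℍ^{n+1}` and normal to `φ`. -/
structure IsUnitNormal {n : ℕ} {M : Type*} [TopologicalSpace M]
    [ChartedSpace (EuclideanSpace ℝ (Fin n)) M] (φ η : M → MinkowskiSpace n) : Prop where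
  smooth : ContMDiff (𝓡 n) 𝓘(ℝ, MinkowskiSpace n) ∞ η
  unit : ∀ x, lorentz (η x) (η x) = 1
  tangent : ∀ x, lorentz (η x) (φ x) = 0
  normal : ∀ x (v : TangentSpace (𝓡 n) x), lorentz (η x) (mvfderiv (𝓡 n) φ x v) = 0

/-- The first fundamental form `⟨dφ, dφ⟩`. -/
def firstFundamentalForm {n : ℕ} {M : Type*} [TopologicalSpace M]
    [ChartedSpace (EuclideanSpace ℝ (Fin n)) M] (φ : M → MinkowskiSpace n) (x : M)
    (v w : TangentSpace (𝓡 n) x) : ℝ :=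
  lorentz (mvfderiv (𝓡 n) φ x v) (mvfderiv (𝓡 n) φ x w)

/-- The second fundamental form `-⟨dφ, dη⟩`. -/
def secondFundamentalForm {n : ℕ} {M : Type*} [TopologicalSpace M]
    [ChartedSpace (EuclideanSpace ℝ (Fin n)) M] (φ η : M → MinkowskiSpace n) (x : M)
    (v w : TangentSpace (𝓡 n) x) : ℝ :=
  -lorentz (mvfderiv (𝓡 n) φ x v) (mvfderiv (𝓡 n) η x w)

/-- For bilinear forms `A` and `B` on `V` (`A` the scalar product), `v` spans an eigendirection of
`B` with respect to `A`, with eigenvalue `μ`: `v` is an eigenvector of `A⁻¹ B`. -/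
def IsEigendirection {V : Type*} [Zero V] (A B : V → V → ℝ) (μ : ℝ) (v : V) : Prop :=
  v ≠ 0 ∧ ∀ w, B v w = μ * A v w

/-- `μ₁, …, μₙ` are the eigenvalues, with multiplicity, of `B` with respect to the scalar product
`A` on the `n`-dimensional space `V`: there are `v₁, …, vₙ` with `A (vᵢ, vⱼ) = δᵢⱼ` and
`B (vᵢ, vⱼ) = μᵢ δᵢⱼ`. -/
def AreEigenvalues {n : ℕ} {V : Type*} (A B : V → V → ℝ) (μ : Fin n → ℝ) : Prop :=
  ∃ v : Fin n → V, ∀ i j,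
    A (v i) (v j) = (if i = j then 1 else 0) ∧ B (v i) (v j) = (if i = j then μ i else 0)

/-- `v` is a principal direction of `φ` (oriented by `η`) at `x`, with principal curvature `k`. -/
def IsPrincipalDirection {n : ℕ} {M : Type*} [TopologicalSpace M]
    [ChartedSpace (EuclideanSpace ℝ (Fin n)) M] (φ η : M → MinkowskiSpace n) (x : M) (k : ℝ)
    (v : TangentSpace (𝓡 n) x) : Prop :=
  IsEigendirection (firstFundamentalForm φ x) (secondFundamentalForm φ η x) k v

/-- `κ₁, …, κₙ` are the principal curvatures, with multiplicity, of `φ` (oriented by `η`) at `x`. -/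
def ArePrincipalCurvatures {n : ℕ} {M : Type*} [TopologicalSpace M]
    [ChartedSpace (EuclideanSpace ℝ (Fin n)) M] (φ η : M → MinkowskiSpace n) (x : M)
    (κ : Fin n → ℝ) : Prop :=
  AreEigenvalues (firstFundamentalForm φ x) (secondFundamentalForm φ η x) κ

/-- The hyperbolic curvature radius `1 / |1 - k|` that belongs to a principal curvature `k`. -/
def hyperbolicCurvatureRadius (k : ℝ) : ℝ := 1 / |1 - k|

/-! ### Horospherical ovaloids -/

/-- The light cone map `ψ = φ + η`. The horosphere tangent to the hypersurface at `x`, with interior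
unit normal `η x` there, is `horosphere (lightConeMap φ η x)`. -/
def lightConeMap {n : ℕ} {M : Type*} (φ η : M → MinkowskiSpace n) (x : M) : MinkowskiSpace n :=
  φ x + η x

/-- The hypersurface `φ` with unit normal `η` is horospherically convex at `p`: near `p` it meets
its tangent horosphere at `p` only in `p`, and its distance to this horosphere does not vanish up to
second order at `p` in any direction. -/
def HorosphericallyConvexAt {n : ℕ} {M : Type*} [TopologicalSpace M]
    [ChartedSpace (EuclideanSpace ℝ (Fin n)) M] (φ η : M → MinkowskiSpace n) (p : M) : Prop :=
  (∃ V ∈ 𝓝 p, ∀ q ∈ V, q ≠ p → φ q ∉ horosphere (lightConeMap φ η p)) ∧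
  ∀ γ : ℝ → M, γ 0 = p → ContMDiffAt 𝓘(ℝ, ℝ) (𝓡 n) ∞ γ 0 →
    mfderiv 𝓘(ℝ, ℝ) (𝓡 n) γ 0 ≠ 0 →
    ¬ ((fun t : ℝ => distToHorosphere (φ (γ t)) (lightConeMap φ η p)) =o[𝓝 0]
      fun t : ℝ => t ^ 2)

/-- A horospherical ovaloid: a compact immersed hypersurface that can be oriented so that it is
horospherically convex at every point. -/
def IsHorosphericalOvaloid {n : ℕ} {M : Type*} [TopologicalSpace M]
    [ChartedSpace (EuclideanSpace ℝ (Fin n)) M] (φ : M → MinkowskiSpace n) : Prop :=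
  CompactSpace M ∧ IsImmersedHypersurface φ ∧
    ∃ η : M → MinkowskiSpace n, IsUnitNormal φ η ∧ ∀ p, HorosphericallyConvexAt φ η p

/-- The canonical orientation of a horospherical ovaloid: the one for which all principal curvatures
are everywhere less than `1`. -/
def IsCanonicalOrientation {n : ℕ} {M : Type*} [TopologicalSpace M]
    [ChartedSpace (EuclideanSpace ℝ (Fin n)) M] (φ η : M → MinkowskiSpace n) : Prop :=
  IsUnitNormal φ η ∧ ∀ x k v, IsPrincipalDirection φ η x k v → k < 1

/-! ### The horospherical metric -/

/-- The hyperbolic Gauss map `G = (ψ₁, …, ψ_{n+1}) / ψ₀`, with values in the unit sphere of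
`ℝ^{n+1}`. -/
def hyperbolicGaussMap {n : ℕ} {M : Type*} (φ η : M → MinkowskiSpace n) (x : M) :
    EuclideanSpace ℝ (Fin (n + 1)) :=
  (lightConeMap φ η x).1⁻¹ • (lightConeMap φ η x).2

/-- The logarithm `ρ` of the horospherical support function `e^ρ = ψ₀`. It is the signed distance
of the tangent horosphere to the point `(1, 0)` of `ℍ^{n+1}`. -/
def logSupport {n : ℕ} {M : Type*} (φ η : M → MinkowskiSpace n) (x : M) : ℝ :=
  Real.log (lightConeMap φ η x).1

/-- The pullback `G^* g₀` of the round metric of the unit sphere under the hyperbolic Gauss map. It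
is `g₀` itself if the hypersurface is parametrized by `G (x) = x`. -/
def gaussPullback {n : ℕ} {M : Type*} [TopologicalSpace M]
    [ChartedSpace (EuclideanSpace ℝ (Fin n)) M] (φ η : M → MinkowskiSpace n) (x : M)
    (v w : TangentSpace (𝓡 n) x) : ℝ :=
  inner ℝ (mvfderiv (𝓡 n) (hyperbolicGaussMap φ η) x v)
    (mvfderiv (𝓡 n) (hyperbolicGaussMap φ η) x w)

/-- The horospherical metric: the pullback of the degenerate metric `e^{2t} g₀` on the space of
horospheres `𝕊ⁿ × ℝ ∋ (x, t)` under the tangent horosphere map `(G, ρ)`. -/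
def horosphericalMetric {n : ℕ} {M : Type*} [TopologicalSpace M]
    [ChartedSpace (EuclideanSpace ℝ (Fin n)) M] (φ η : M → MinkowskiSpace n) (x : M)
    (v w : TangentSpace (𝓡 n) x) : ℝ :=
  Real.exp (2 * logSupport φ η x) * gaussPullback φ η x v w

/-! ### Curvature of a Riemannian metric in local coordinates -/

/-- The partial derivative `∂ᵢ f` at `y`. -/
def partialDeriv {n : ℕ} (i : Fin n) (f : EuclideanSpace ℝ (Fin n) → ℝ)
    (y : EuclideanSpace ℝ (Fin n)) : ℝ :=
  fderiv ℝ f y (EuclideanSpace.single i 1)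

/-- The Christoffel symbol `Γᵏᵢⱼ = ½ gᵏˡ (∂ᵢ gⱼₗ + ∂ⱼ gᵢₗ - ∂ₗ gᵢⱼ)` of the metric `gᵢⱼ`. -/
def christoffel {n : ℕ} (g : EuclideanSpace ℝ (Fin n) → Matrix (Fin n) (Fin n) ℝ)
    (k i j : Fin n) (y : EuclideanSpace ℝ (Fin n)) : ℝ :=
  (1 / 2) * ∑ l, (g y)⁻¹ k l *
    (partialDeriv i (fun z => g z j l) y + partialDeriv j (fun z => g z i l) y
      - partialDeriv l (fun z => g z i j) y)

/-- The Ricci curvature `Rᵢⱼ = ∂ₖ Γᵏᵢⱼ - ∂ⱼ Γᵏᵢₖ + Γᵏₖₗ Γˡᵢⱼ - Γᵏⱼₗ Γˡᵢₖ` of the metric `gᵢⱼ`. -/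
def ricciCoord {n : ℕ} (g : EuclideanSpace ℝ (Fin n) → Matrix (Fin n) (Fin n) ℝ)
    (y : EuclideanSpace ℝ (Fin n)) (i j : Fin n) : ℝ :=
  ∑ k, (partialDeriv k (christoffel g k i j) y - partialDeriv j (christoffel g k i k) y)
    + ∑ k, ∑ l, (christoffel g k k l y * christoffel g l i j y
      - christoffel g k j l y * christoffel g l i k y)

/-- The coordinate vector field `∂ᵢ` of the preferred chart at `x`, at the point with coordinates
`y`. -/
def coordVector {n : ℕ} {M : Type*} [TopologicalSpace M]
    [ChartedSpace (EuclideanSpace ℝ (Fin n)) M] (x : M) (i : Fin n)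
    (y : EuclideanSpace ℝ (Fin n)) : TangentSpace (𝓡 n) ((extChartAt (𝓡 n) x).symm y) :=
  mfderiv 𝓘(ℝ, EuclideanSpace ℝ (Fin n)) (𝓡 n) (extChartAt (𝓡 n) x).symm y
    (EuclideanSpace.single i (1 : ℝ) : EuclideanSpace ℝ (Fin n))

/-- The components `gᵢⱼ` of a metric in the preferred chart at `x`. -/
def metricCoord {n : ℕ} {M : Type*} [TopologicalSpace M]
    [ChartedSpace (EuclideanSpace ℝ (Fin n)) M]
    (g : ∀ x : M, TangentSpace (𝓡 n) x → TangentSpace (𝓡 n) x → ℝ) (x : M)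
    (y : EuclideanSpace ℝ (Fin n)) : Matrix (Fin n) (Fin n) ℝ :=
  Matrix.of fun i j => g ((extChartAt (𝓡 n) x).symm y) (coordVector x i y) (coordVector x j y)

/-- The components of a tangent vector at `x` in the preferred chart at `x`. -/
def vectorCoord {n : ℕ} {M : Type*} [TopologicalSpace M]
    [ChartedSpace (EuclideanSpace ℝ (Fin n)) M] (x : M) (v : TangentSpace (𝓡 n) x) :
    EuclideanSpace ℝ (Fin n) :=
  mfderiv (𝓡 n) 𝓘(ℝ, EuclideanSpace ℝ (Fin n)) (extChartAt (𝓡 n) x) x v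

/-- The Ricci tensor of a metric `g` on `M`. -/
def ricciTensor {n : ℕ} {M : Type*} [TopologicalSpace M]
    [ChartedSpace (EuclideanSpace ℝ (Fin n)) M]
    (g : ∀ x : M, TangentSpace (𝓡 n) x → TangentSpace (𝓡 n) x → ℝ) (x : M)
    (v w : TangentSpace (𝓡 n) x) : ℝ :=
  ∑ i, ∑ j, ricciCoord (metricCoord g x) (extChartAt (𝓡 n) x x) i j
    * vectorCoord x v i * vectorCoord x w j

/-- The scalar curvature `S(g) = gⁱʲ Rᵢⱼ` of a metric `g` on `M`. -/
def scalarCurvature {n : ℕ} {M : Type*} [TopologicalSpace M]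
    [ChartedSpace (EuclideanSpace ℝ (Fin n)) M]
    (g : ∀ x : M, TangentSpace (𝓡 n) x → TangentSpace (𝓡 n) x → ℝ) (x : M) : ℝ :=
  ∑ i, ∑ j, (metricCoord g x (extChartAt (𝓡 n) x x))⁻¹ i j
    * ricciCoord (metricCoord g x) (extChartAt (𝓡 n) x x) i j

/-- The Schouten tensor `(Ric - S / (2 (n - 1)) g) / (n - 2)` of a metric `g` on a manifold of
dimension `n > 2`. -/
def schoutenTensor {n : ℕ} {M : Type*} [TopologicalSpace M]
    [ChartedSpace (EuclideanSpace ℝ (Fin n)) M]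
    (g : ∀ x : M, TangentSpace (𝓡 n) x → TangentSpace (𝓡 n) x → ℝ) (x : M)
    (v w : TangentSpace (𝓡 n) x) : ℝ :=
  1 / ((n : ℝ) - 2) *
    (ricciTensor g x v w - scalarCurvature g x / (2 * ((n : ℝ) - 1)) * g x v w)

/-- The Hessian components `∂ᵢ ∂ⱼ r - Γᵏᵢⱼ ∂ₖ r` for the metric `hᵢⱼ`. -/
def hessianCoord {n : ℕ} (h : EuclideanSpace ℝ (Fin n) → Matrix (Fin n) (Fin n) ℝ)
    (r : EuclideanSpace ℝ (Fin n) → ℝ) (y : EuclideanSpace ℝ (Fin n)) (i j : Fin n) : ℝ :=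
  partialDeriv i (partialDeriv j r) y - ∑ k, christoffel h k i j y * partialDeriv k r y

/-- The Hessian `∇²ρ` of a function with respect to a metric `h` on `M`. -/
def hessianTensor {n : ℕ} {M : Type*} [TopologicalSpace M]
    [ChartedSpace (EuclideanSpace ℝ (Fin n)) M]
    (h : ∀ x : M, TangentSpace (𝓡 n) x → TangentSpace (𝓡 n) x → ℝ) (ρ : M → ℝ) (x : M)
    (v w : TangentSpace (𝓡 n) x) : ℝ :=
  ∑ i, ∑ j, hessianCoord (metricCoord h x) (ρ ∘ (extChartAt (𝓡 n) x).symm)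
    (extChartAt (𝓡 n) x x) i j * vectorCoord x v i * vectorCoord x w j

/-- The squared norm `‖∇ρ‖² = hⁱʲ ∂ᵢρ ∂ⱼρ` of the gradient of a function for a metric `h`. -/
def gradNormSq {n : ℕ} {M : Type*} [TopologicalSpace M]
    [ChartedSpace (EuclideanSpace ℝ (Fin n)) M]
    (h : ∀ x : M, TangentSpace (𝓡 n) x → TangentSpace (𝓡 n) x → ℝ) (ρ : M → ℝ) (x : M) : ℝ :=
  ∑ i, ∑ j, (metricCoord h x (extChartAt (𝓡 n) x x))⁻¹ i j
    * partialDeriv i (ρ ∘ (extChartAt (𝓡 n) x).symm) (extChartAt (𝓡 n) x x)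
    * partialDeriv j (ρ ∘ (extChartAt (𝓡 n) x).symm) (extChartAt (𝓡 n) x x)

/-- The Schouten tensor of the metric `e^{2ρ} h` that is conformal to a metric `h` of constant
curvature `1`, in the form
`-∇²ρ + dρ ⊗ dρ - ½ (-1 + ‖∇ρ‖²) h` (everything with respect to `h`), which makes sense also in
dimension `2`. -/
def conformalSchoutenTensor {n : ℕ} {M : Type*} [TopologicalSpace M]
    [ChartedSpace (EuclideanSpace ℝ (Fin n)) M]
    (h : ∀ x : M, TangentSpace (𝓡 n) x → TangentSpace (𝓡 n) x → ℝ) (ρ : M → ℝ) (x : M)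
    (v w : TangentSpace (𝓡 n) x) : ℝ :=
  -hessianTensor h ρ x v w + mvfderiv (𝓡 n) ρ x v * mvfderiv (𝓡 n) ρ x w
    - 1 / 2 * (-1 + gradNormSq h ρ x) * h x v w

/-- The Schouten tensor of the horospherical metric `g = e^{2ρ} G^* g₀`. For `n > 2` it is the
Schouten tensor of the Riemannian metric `g`. For `n = 2` it is the two-dimensional Schouten tensor
of a metric conformal to the round metric of the sphere, which is carried over to `M` by `G`. -/
def horosphericalSchouten {n : ℕ} {M : Type*} [TopologicalSpace M]
    [ChartedSpace (EuclideanSpace ℝ (Fin n)) M] (φ η : M → MinkowskiSpace n) (x : M)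
    (v w : TangentSpace (𝓡 n) x) : ℝ :=
  if n = 2 then conformalSchoutenTensor (gaussPullback φ η) (logSupport φ η) x v w
  else schoutenTensor (horosphericalMetric φ η) x v w

/-- `v` is an eigendirection of `Sch_g` at `x` with eigenvalue `l`, for the horospherical
metric `g`. -/
def IsSchoutenEigendirection {n : ℕ} {M : Type*} [TopologicalSpace M]
    [ChartedSpace (EuclideanSpace ℝ (Fin n)) M] (φ η : M → MinkowskiSpace n) (x : M) (l : ℝ)
    (v : TangentSpace (𝓡 n) x) : Prop :=
  IsEigendirection (horosphericalMetric φ η x) (horosphericalSchouten φ η x) l v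

/-- `lam₁, …, lamₙ` are the eigenvalues, with multiplicity, of the Schouten tensor of the
horospherical metric at `x`. -/
def AreSchoutenEigenvalues {n : ℕ} {M : Type*} [TopologicalSpace M]
    [ChartedSpace (EuclideanSpace ℝ (Fin n)) M] (φ η : M → MinkowskiSpace n) (x : M)
    (lam : Fin n → ℝ) : Prop :=
  AreEigenvalues (horosphericalMetric φ η x) (horosphericalSchouten φ η x) lam

end

/-! The light cone map `ψ = φ + η` carries the whole argument. It is null, `⟨φ, ψ⟩ = -1`, and `φ` is
a timelike unit normal of `ψ`. Principal curvatures below `1` make `ψ` an immersion: a vector killed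
by `dψ` would be a principal direction with curvature `1`. Rescaling a null map rescales its induced
metric conformally, so from `ψ = e^ρ (1, G)` the horospherical metric is `g = ⟨dψ, dψ⟩`
(`horosphericalMetric_eq`).

The key identity is `Sch_g = ½ g - ⟨dψ, dφ⟩` (`horosphericalSchouten_eq`). For `n > 2` it is the
Gauss equation of `ψ` in flat Minkowski space, whose normal bundle is spanned by `ψ` and `φ`;
tracing gives `Ric` and `S` (`ricciCoord_gram`, `schouten_gram`). For `n = 2` the defining
expression in `ρ` is computed from the immersion `(1, G)`, which has the constant normal `(1, 0)`,
by testing its Gauss formula against `φ` (`conformalSchouten_gram`).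

A vector orthogonal to `φ`, `ψ` and the `n`-dimensional tangent space vanishes
(`eq_zero_of_orthogonal_frame`). Eigenvalue equations of forms thus become equations of vectors: `v`
is principal with curvature `k` iff `dψ(v) = (1 - k) dφ(v)`, and a Schouten eigendirection with
eigenvalue `l` iff `dφ(v) = (½ - l) dψ(v)`. Hence the directions agree and `(½ - l)(1 - k) = 1`. For
multiplicities, an orthonormal principal frame rescaled by `1 / (1 - κᵢ)` is `g`-orthonormal and
diagonalizes `Sch_g`; eigenvalue families are unique up to order (`AreEigenvalues.exists_perm`). -/

noncomputable section

/-! ### Eigenvalues of a symmetric bilinear form with respect to a scalar product -/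

section Eigenvalues

variable {V : Type*} [AddCommGroup V] [Module ℝ V] [FiniteDimensional ℝ V] {n : ℕ}

/-- Spectral theorem: with `A` as inner product, the endomorphism `A⁻¹ B` is symmetric, and an
orthonormal eigenbasis of it diagonalizes both forms. -/
theorem exists_areEigenvalues (A B : LinearMap.BilinForm ℝ V)
    (hd : Module.finrank ℝ V = n) (hA : ∀ v w, A v w = A w v) (hB : ∀ v w, B v w = B w v)
    (hpos : ∀ v, v ≠ 0 → 0 < A v v) :
    ∃ μ : Fin n → ℝ, AreEigenvalues (fun v w => A v w) (fun v w => B v w) μ := by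
  let core : InnerProductSpace.Core ℝ V :=
    { inner := fun v w => A v w
      conj_inner_symm := fun v w => by simpa using hA w v
      re_inner_nonneg := fun v => by
        rcases eq_or_ne v 0 with rfl | h
        · simp
        · simpa using (hpos v h).le
      add_left := fun u v w => by simp
      smul_left := fun u v r => by simp
      definite := fun v h => by
        by_contra hv
        exact (hpos v hv).ne' h }
  let _ : NormedAddCommGroup V := core.toNormedAddCommGroup
  let _ : InnerProductSpace ℝ V := InnerProductSpace.ofCore core.toCore
  have hin : ∀ v w : V, inner ℝ v w = A v w := fun _ _ => rfl
  have hnd : A.Nondegenerate := by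
    refine ⟨fun v h => ?_, fun v h => ?_⟩ <;>
    · by_contra hv
      exact (hpos v hv).ne' (h v)
  let T : V →ₗ[ℝ] V := (LinearMap.BilinForm.toDual A hnd).symm.toLinearMap ∘ₗ B
  have hT : ∀ v w, inner ℝ (T v) w = B v w := fun v w => by
    rw [hin]
    exact LinearMap.BilinForm.apply_toDual_symm_apply (hB := hnd) _ _
  have hsym : T.IsSymmetric := fun v w => by
    rw [hT, real_inner_comm, hT, hB]
  refine ⟨hsym.eigenvalues hd, hsym.eigenvectorBasis hd, fun i j => ⟨?_, ?_⟩⟩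
  · exact (hin _ _).symm.trans (orthonormal_iff_ite.1 (hsym.eigenvectorBasis hd).orthonormal i j)
  · refine (hT _ _).symm.trans ?_
    rw [hsym.apply_eigenvectorBasis, inner_smul_left,
      orthonormal_iff_ite.1 (hsym.eigenvectorBasis hd).orthonormal]
    simp

theorem exists_basis_of_bilin_orthonormal {A : LinearMap.BilinForm ℝ V} {v : Fin n → V}
    (hd : Module.finrank ℝ V = n) (h : ∀ i j, A (v i) (v j) = if i = j then 1 else 0) :
    ∃ b : Module.Basis (Fin n) ℝ V, ⇑b = v := by
  have hli : LinearIndependent ℝ v := by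
    rw [Fintype.linearIndependent_iff]
    intro c hc i
    have := congrArg (fun u => A u (v i)) hc
    simpa [LinearMap.sum_apply, h] using this
  exact ⟨basisOfLinearIndependentOfCardEqFinrank' v hli (by simp [hd]), by simp⟩

/-- Vectors that diagonalize `B` with respect to `A` are eigendirections. -/
theorem isEigendirection_of_diagonal {A B : LinearMap.BilinForm ℝ V} {v : Fin n → V}
    {μ : Fin n → ℝ} (hd : Module.finrank ℝ V = n)
    (h : ∀ i j, A (v i) (v j) = (if i = j then 1 else 0) ∧
      B (v i) (v j) = (if i = j then μ i else 0)) (i : Fin n) :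
    IsEigendirection (fun v w => A v w) (fun v w => B v w) (μ i) (v i) := by
  obtain ⟨b, rfl⟩ := exists_basis_of_bilin_orthonormal hd fun i j => (h i j).1
  refine ⟨b.ne_zero i, fun w => ?_⟩
  have : B (b i) = μ i • A (b i) := b.ext fun j => by
    simp [(h i j).1, (h i j).2]
  simp [this]

/-- Equal multisets of values mean that the fibres over each value have equal cardinality;
bijections of the fibres glue to a permutation. -/
theorem Multiset.exists_perm_of_map_univ_eq {ι α : Type*} [Fintype ι] {f g : ι → α}
    (h : Multiset.map f Finset.univ.val = Multiset.map g Finset.univ.val) :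
    ∃ σ : Equiv.Perm ι, ∀ i, f i = g (σ i) := by
  classical
  have hc : ∀ c, Nonempty ({i // f i = c} ≃ {i // g i = c}) := fun c => by
    refine ⟨Fintype.equivOfCardEq ?_⟩
    have := congrArg (Multiset.count c) h
    simp only [Multiset.count_map] at this
    rw [Fintype.card_subtype, Fintype.card_subtype]
    simpa [Finset.card_def, Finset.filter_val, eq_comm] using this
  let σ : Equiv.Perm ι := Equiv.ofFiberEquiv fun c => (hc c).some
  exact ⟨σ, fun i => (Equiv.ofFiberEquiv_map (fun c => (hc c).some) i).symm⟩

/-- Both families are the roots, with multiplicity, of the characteristic polynomial of the one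
endomorphism `T = A⁻¹ B`. Neither symmetry nor positivity of `A` is assumed: an `A`-orthonormal
basis already provides the nondegeneracy. -/
theorem AreEigenvalues.exists_perm {A B : LinearMap.BilinForm ℝ V} {μ ν : Fin n → ℝ}
    (hd : Module.finrank ℝ V = n)
    (hμ : AreEigenvalues (fun v w => A v w) (fun v w => B v w) μ)
    (hν : AreEigenvalues (fun v w => A v w) (fun v w => B v w) ν) :
    ∃ σ : Equiv.Perm (Fin n), ∀ i, μ i = ν (σ i) := by
  obtain ⟨v, hv⟩ := hμ
  obtain ⟨w, hw⟩ := hν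
  have hev := fun i => (isEigendirection_of_diagonal hd hv i).2
  have hew := fun i => (isEigendirection_of_diagonal hd hw i).2
  obtain ⟨b, rfl⟩ := exists_basis_of_bilin_orthonormal hd fun i j => (hv i j).1
  obtain ⟨c, rfl⟩ := exists_basis_of_bilin_orthonormal hd fun i j => (hw i j).1
  -- `T` is defined as diagonal in the first basis; `hT` characterizes it by `A` and `B` alone, so
  -- the second basis diagonalizes it as well.
  let T : V →ₗ[ℝ] V := b.constr ℝ fun i => μ i • b i
  have hTb : ∀ i, T (b i) = μ i • b i := fun i => by simp [T]
  have hT : ∀ u z, A (T u) z = B u z := fun u z => by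
    have : A ∘ₗ T = B := b.ext fun i => LinearMap.ext fun z => by
      simp [hTb, hev i z]
    rw [← this]; rfl
  have hAsep : ∀ u, (∀ j, A u (b j) = 0) → u = 0 := fun u hu => by
    have : ∀ j, b.repr u j = 0 := fun j => by
      have h := hu j
      have hbb : ∀ i, A (b i) (b j) = if i = j then 1 else 0 := fun i => (hv i j).1
      rw [← b.sum_repr u, map_sum, LinearMap.sum_apply] at h
      simpa only [map_smul, LinearMap.smul_apply, hbb, smul_eq_mul, mul_ite, mul_one, mul_zero,
        Finset.sum_ite_eq', Finset.mem_univ, if_true] using h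
    exact (b.repr.map_eq_zero_iff).1 (Finsupp.ext this)
  have hTc : ∀ i, T (c i) = ν i • c i := fun i => by
    rw [← sub_eq_zero]
    refine hAsep _ fun j => ?_
    have := hew i (b j)
    simp only at this
    simp [hT, this]
  have key : ∀ (b : Module.Basis (Fin n) ℝ V) (μ : Fin n → ℝ), (∀ i, T (b i) = μ i • b i) →
      T.charpoly.roots = Multiset.map μ Finset.univ.val := fun b μ h => by
    have : LinearMap.toMatrix b b T = Matrix.diagonal μ := by
      ext i j
      rw [LinearMap.toMatrix_apply, h, Matrix.diagonal_apply]
      by_cases hij : i = j <;> simp [hij]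
    rw [← LinearMap.charpoly_toMatrix T b, this, Matrix.charpoly_diagonal]
    have h := Polynomial.roots_multiset_prod_X_sub_C (Multiset.map μ Finset.univ.val)
    rwa [Multiset.map_map] at h
  exact Multiset.exists_perm_of_map_univ_eq ((key b μ hTb).symm.trans (key c ν hTc))

end Eigenvalues

/-! ### The Lorentzian metric -/

section Lorentz

variable {n : ℕ}

theorem lorentz_comm (p q : MinkowskiSpace n) : lorentz p q = lorentz q p := by
  simp only [lorentz, real_inner_comm q.2 p.2, mul_comm]

theorem lorentz_add_left (p q r : MinkowskiSpace n) :
    lorentz (p + q) r = lorentz p r + lorentz q r := by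
  simp only [lorentz, Prod.fst_add, Prod.snd_add, inner_add_left]; ring

theorem lorentz_smul_left (c : ℝ) (p q : MinkowskiSpace n) :
    lorentz (c • p) q = c * lorentz p q := by
  simp only [lorentz, Prod.smul_fst, Prod.smul_snd, inner_smul_left, smul_eq_mul]
  simp; ring

theorem lorentz_add_right (p q r : MinkowskiSpace n) :
    lorentz p (q + r) = lorentz p q + lorentz p r := by
  simp only [lorentz_comm p, lorentz_add_left]

theorem lorentz_smul_right (c : ℝ) (p q : MinkowskiSpace n) :
    lorentz p (c • q) = c * lorentz p q := by
  simp only [lorentz_comm p, lorentz_smul_left]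

/-- The Lorentzian metric as a bilinear form. -/
def lorentzForm (n : ℕ) : LinearMap.BilinForm ℝ (MinkowskiSpace n) :=
  LinearMap.mk₂ ℝ lorentz lorentz_add_left lorentz_smul_left lorentz_add_right lorentz_smul_right

theorem lorentzForm_apply (p q : MinkowskiSpace n) : lorentzForm n p q = lorentz p q := rfl

theorem lorentz_zero_left (p : MinkowskiSpace n) : lorentz 0 p = 0 := by
  simp [← lorentzForm_apply]

theorem lorentz_zero_right (p : MinkowskiSpace n) : lorentz p 0 = 0 := by
  simp [← lorentzForm_apply]

theorem lorentz_neg_right (p q : MinkowskiSpace n) : lorentz p (-q) = -lorentz p q := by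
  simp [← lorentzForm_apply]

theorem lorentz_sub_right (p q r : MinkowskiSpace n) :
    lorentz p (q - r) = lorentz p q - lorentz p r := by
  simp [← lorentzForm_apply]

theorem lorentz_sum_left {ι : Type*} (s : Finset ι) (f : ι → MinkowskiSpace n)
    (p : MinkowskiSpace n) : lorentz (∑ i ∈ s, f i) p = ∑ i ∈ s, lorentz (f i) p := by
  simp [← lorentzForm_apply, LinearMap.sum_apply]

theorem lorentz_sum_right {ι : Type*} (s : Finset ι) (f : ι → MinkowskiSpace n)
    (p : MinkowskiSpace n) : lorentz p (∑ i ∈ s, f i) = ∑ i ∈ s, lorentz p (f i) := by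
  simp [← lorentzForm_apply]

/-- The orthogonal complement of a timelike vector is spacelike. -/
theorem lorentz_self_pos_of_orthogonal {p u : MinkowskiSpace n} (hp : lorentz p p < 0)
    (hpu : lorentz p u = 0) (hu : u ≠ 0) : 0 < lorentz u u := by
  have hcs := abs_real_inner_le_norm p.2 u.2
  have h1 : inner ℝ p.2 u.2 = p.1 * u.1 := by simp only [lorentz] at hpu; linarith
  simp only [lorentz, real_inner_self_eq_norm_sq] at hp ⊢
  rw [h1] at hcs
  have h2 : p.1 ^ 2 * u.1 ^ 2 ≤ ‖p.2‖ ^ 2 * ‖u.2‖ ^ 2 := by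
    have := pow_le_pow_left₀ (abs_nonneg _) hcs 2
    rwa [sq_abs, mul_pow, mul_pow] at this
  have h3 : ‖p.2‖ ^ 2 < p.1 ^ 2 := by nlinarith
  rcases eq_or_ne u.2 0 with h0 | h0
  · rw [h0, inner_zero_right] at h1
    have hp1 : p.1 ≠ 0 := fun h => by rw [h] at h3; nlinarith [sq_nonneg ‖p.2‖]
    have : u.1 = 0 := by simpa [hp1] using h1.symm
    exact absurd (Prod.ext this h0) hu
  · have hpos : 0 < ‖u.2‖ ^ 2 := by positivity
    by_contra hle
    have h4 : ‖u.2‖ ^ 2 ≤ u.1 ^ 2 := by nlinarith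
    -- The contradiction is `p₀² ‖u₂‖² ≤ p₀² u₀² ≤ ‖p₂‖² ‖u₂‖² < p₀² ‖u₂‖²`, writing `p₀` for `p.1`
    -- and `p₂` for `p.2`, and likewise for `u`.
    nlinarith [mul_pos (sub_pos.2 h3) hpos, mul_le_mul_of_nonneg_left h4 (sq_nonneg p.1)]

theorem eq_zero_of_lorentz_self_eq_zero {p u : MinkowskiSpace n} (hp : lorentz p p < 0)
    (hpu : lorentz p u = 0) (hu : lorentz u u = 0) : u = 0 := by
  by_contra h
  exact (lorentz_self_pos_of_orthogonal hp hpu h).ne' hu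

/-- If `⟨p, p⟩ = ⟨p, q⟩ = -1` and `⟨q, q⟩ = 0`, and `f` maps an `n`-dimensional space injectively
into the orthogonal complement of `p` and `q`, then only `0` is orthogonal to `p`, `q` and the range
of `f`. -/
theorem eq_zero_of_orthogonal_frame {V : Type*} [AddCommGroup V] [Module ℝ V]
    [FiniteDimensional ℝ V] (hd : Module.finrank ℝ V = n) {p q u : MinkowskiSpace n}
    (f : V →ₗ[ℝ] MinkowskiSpace n) (hf : Function.Injective f)
    (hpp : lorentz p p = -1) (hpq : lorentz p q = -1) (hqq : lorentz q q = 0)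
    (hpf : ∀ v, lorentz p (f v) = 0) (hqf : ∀ v, lorentz q (f v) = 0)
    (hpu : lorentz p u = 0) (hqu : lorentz q u = 0) (hfu : ∀ v, lorentz (f v) u = 0) : u = 0 := by
  by_contra hu
  have huu := lorentz_self_pos_of_orthogonal (by rw [hpp]; norm_num) hpu hu
  -- A nonzero `u` is spacelike, hence independent of `p`, `q` and the range of `f`. This would
  -- embed a space of dimension `n + 3` into Minkowski space, which has dimension `n + 2`.
  let F : (V × ℝ × ℝ × ℝ) →ₗ[ℝ] MinkowskiSpace n :=
    f.coprod ((LinearMap.toSpanSingleton ℝ _ p).coprod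
      ((LinearMap.toSpanSingleton ℝ _ q).coprod (LinearMap.toSpanSingleton ℝ _ u)))
  have hF : ∀ v a b c, F (v, a, b, c) = f v + (a • p + (b • q + c • u)) := fun _ _ _ _ => by
    simp [F]
  have hinj : Function.Injective F := by
    rw [← LinearMap.ker_eq_bot, LinearMap.ker_eq_bot']
    rintro ⟨v, a, b, c⟩ h
    rw [hF] at h
    -- Pairing with `q` isolates `a`, then pairing with `p` gives `b`, and pairing with `u` gives
    -- `c`.
    have e1 := congrArg (lorentz q) h
    have e2 := congrArg (lorentz p) h
    have e3 := congrArg (lorentz u) h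
    simp only [lorentz_add_right, lorentz_smul_right, lorentz_zero_right, hpf, hqf, hqq, hpp, hpq,
      hpu, hqu, lorentz_comm u p, lorentz_comm u q, lorentz_comm u (f _), hfu,
      lorentz_comm q p] at e1 e2 e3
    have ha : a = 0 := by linarith
    have hb : b = 0 := by linarith
    have hc : c = 0 := by
      have : c * lorentz u u = 0 := by linarith
      exact (mul_eq_zero.1 this).resolve_right huu.ne'
    subst ha hb hc
    have : v = 0 := hf (by simpa using h)
    simp [this]
  have := LinearMap.finrank_le_finrank_of_injective hinj
  simp [hd] at this
  omega

end Lorentz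

/-! ### Calculus of vector-valued maps on an open subset of `ℝⁿ` -/

section Calculus

variable {n : ℕ} {F : Type*} [NormedAddCommGroup F] [NormedSpace ℝ F]
  {U : Set (EuclideanSpace ℝ (Fin n))} {y : EuclideanSpace ℝ (Fin n)}

/-- The partial derivative `∂ᵢ f` of a vector-valued map. -/
def vpartial (i : Fin n) (f : EuclideanSpace ℝ (Fin n) → F) (y : EuclideanSpace ℝ (Fin n)) : F :=
  fderiv ℝ f y (EuclideanSpace.single i 1)

theorem partialDeriv_eq_vpartial (i : Fin n) (f : EuclideanSpace ℝ (Fin n) → ℝ) :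
    partialDeriv i f = vpartial i f := rfl

theorem fderiv_eq_sum_vpartial (f : EuclideanSpace ℝ (Fin n) → F) (y v : EuclideanSpace ℝ (Fin n)) :
    fderiv ℝ f y v = ∑ i, v i • vpartial i f y := by
  have hv : v = ∑ i, v i • (EuclideanSpace.single i 1 : EuclideanSpace ℝ (Fin n)) := by
    ext j
    simp [Finset.sum_apply, Pi.single_apply]
  conv_lhs => rw [hv]
  simp [vpartial]

theorem ContDiffOn.differentiableAt_of_isOpen {f : EuclideanSpace ℝ (Fin n) → F}
    (hf : ContDiffOn ℝ ∞ f U) (hU : IsOpen U) (hy : y ∈ U) : DifferentiableAt ℝ f y :=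
  (hf.contDiffAt (hU.mem_nhds hy)).differentiableAt (by simp)

theorem ContDiffOn.vpartial {f : EuclideanSpace ℝ (Fin n) → F} (hf : ContDiffOn ℝ ∞ f U)
    (hU : IsOpen U) (i : Fin n) : ContDiffOn ℝ ∞ (vpartial i f) U :=
  (hf.fderiv_of_isOpen hU (m := ∞) (by simp)).clm_apply contDiffOn_const

theorem vpartial_congr {f g : EuclideanSpace ℝ (Fin n) → F} (hU : IsOpen U)
    (h : ∀ z ∈ U, f z = g z) (hy : y ∈ U) (i : Fin n) : vpartial i f y = vpartial i g y := by
  have : f =ᶠ[𝓝 y] g := Filter.eventually_of_mem (hU.mem_nhds hy) h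
  rw [vpartial, this.fderiv_eq, vpartial]

theorem vpartial_comm {f : EuclideanSpace ℝ (Fin n) → F} (hf : ContDiffOn ℝ ∞ f U)
    (hU : IsOpen U) (hy : y ∈ U) (i j : Fin n) :
    vpartial i (vpartial j f) y = vpartial j (vpartial i f) y := by
  have hs := (hf.contDiffAt (hU.mem_nhds hy)).isSymmSndFDerivAt
    (by simpa using WithTop.coe_le_coe.2 (le_top : (2 : ℕ∞) ≤ ⊤))
  have hd : DifferentiableAt ℝ (fderiv ℝ f) y :=
    (hf.fderiv_of_isOpen hU (m := ∞) (by simp)).differentiableAt_of_isOpen hU hy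
  have key : ∀ a b : Fin n, vpartial a (vpartial b f) y =
      fderiv ℝ (fderiv ℝ f) y (EuclideanSpace.single a 1) (EuclideanSpace.single b 1) := by
    intro a b
    have := fderiv_clm_apply hd (differentiableAt_const
      (EuclideanSpace.single b 1 : EuclideanSpace ℝ (Fin n)))
    change fderiv ℝ (fun z => fderiv ℝ f z (EuclideanSpace.single b 1)) y _ = _
    rw [this]
    simp
  rw [key, key]
  exact hs _ _

theorem vpartial_add {f g : EuclideanSpace ℝ (Fin n) → F} (hf : DifferentiableAt ℝ f y)
    (hg : DifferentiableAt ℝ g y) (i : Fin n) :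
    vpartial i (fun z => f z + g z) y = vpartial i f y + vpartial i g y := by
  simp [vpartial, fderiv_fun_add hf hg]

theorem vpartial_sum {ι : Type*} {s : Finset ι} {f : ι → EuclideanSpace ℝ (Fin n) → F}
    (hf : ∀ k ∈ s, DifferentiableAt ℝ (f k) y) (i : Fin n) :
    vpartial i (fun z => ∑ k ∈ s, f k z) y = ∑ k ∈ s, vpartial i (f k) y := by
  simp [vpartial, fderiv_fun_sum hf]

theorem vpartial_smul {c : EuclideanSpace ℝ (Fin n) → ℝ} {f : EuclideanSpace ℝ (Fin n) → F}
    (hc : DifferentiableAt ℝ c y) (hf : DifferentiableAt ℝ f y) (i : Fin n) :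
    vpartial i (fun z => c z • f z) y = vpartial i c y • f y + c y • vpartial i f y := by
  simp [vpartial, fderiv_fun_smul hc hf, add_comm]

theorem vpartial_const (c : F) (i : Fin n) : vpartial i (fun _ => c) y = 0 := by
  simp [vpartial]

theorem fderiv_lorentz_apply {m : ℕ} {f g : EuclideanSpace ℝ (Fin n) → MinkowskiSpace m}
    (hf : DifferentiableAt ℝ f y) (hg : DifferentiableAt ℝ g y) (v : EuclideanSpace ℝ (Fin n)) :
    fderiv ℝ (fun z => lorentz (f z) (g z)) y v =
      lorentz (fderiv ℝ f y v) (g y) + lorentz (f y) (fderiv ℝ g y v) := by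
  have := (lorentzForm m).toContinuousBilinearMap.fderiv_of_bilinear hf hg
  have h2 := congrArg (fun T => T v) this
  simp only [LinearMap.toContinuousBilinearMap_apply, lorentzForm_apply] at h2
  rw [h2]
  simp [ContinuousLinearMap.precompR, ContinuousLinearMap.precompL, lorentzForm_apply, add_comm]

theorem vpartial_lorentz {m : ℕ} {f g : EuclideanSpace ℝ (Fin n) → MinkowskiSpace m}
    (hf : DifferentiableAt ℝ f y) (hg : DifferentiableAt ℝ g y) (i : Fin n) :
    vpartial i (fun z => lorentz (f z) (g z)) y =
      lorentz (vpartial i f y) (g y) + lorentz (f y) (vpartial i g y) :=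
  fderiv_lorentz_apply hf hg _

theorem ContDiffOn.lorentz {m : ℕ} {f g : EuclideanSpace ℝ (Fin n) → MinkowskiSpace m}
    (hf : ContDiffOn ℝ ∞ f U) (hg : ContDiffOn ℝ ∞ g U) :
    ContDiffOn ℝ ∞ (fun z => lorentz (f z) (g z)) U := by
  have := (lorentzForm m).toContinuousBilinearMap.isBoundedBilinearMap.contDiff (n := ∞)
  exact this.comp_contDiffOn (hf.prodMk hg)

/-- Cramer's rule: entries of the inverse are quotients of determinants, which are polynomial in the
entries of the matrix. -/
theorem contDiffOn_matrix_inv {M : EuclideanSpace ℝ (Fin n) → Matrix (Fin n) (Fin n) ℝ}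
    (hM : ∀ i j, ContDiffOn ℝ ∞ (fun z => M z i j) U) (hdet : ∀ z ∈ U, (M z).det ≠ 0)
    (i j : Fin n) : ContDiffOn ℝ ∞ (fun z => (M z)⁻¹ i j) U := by
  have hd : ∀ N : EuclideanSpace ℝ (Fin n) → Matrix (Fin n) (Fin n) ℝ,
      (∀ i j, ContDiffOn ℝ ∞ (fun z => N z i j) U) → ContDiffOn ℝ ∞ (fun z => (N z).det) U := by
    intro N hN
    simp only [Matrix.det_apply]
    exact ContDiffOn.sum fun σ _ => (contDiffOn_prod fun k _ => hN _ _).const_smul _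
  have hadj : ContDiffOn ℝ ∞ (fun z => (M z).adjugate i j) U := by
    simp only [Matrix.adjugate_apply]
    refine hd _ fun a b => ?_
    simp only [Matrix.updateRow_apply]
    by_cases h : a = j
    · simpa [h] using contDiffOn_const
    · simpa [h] using hM a b
  simp only [Matrix.inv_def, Ring.inverse_eq_inv', Matrix.smul_apply, smul_eq_mul]
  exact ((hd M hM).inv hdet).mul hadj

end Calculus

/-! ### Locality: coordinate curvature depends only on the metric on an open set, such as a chart
target -/

theorem christoffel_congr {n : ℕ} {g g' : EuclideanSpace ℝ (Fin n) → Matrix (Fin n) (Fin n) ℝ}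
    {U : Set (EuclideanSpace ℝ (Fin n))} (hU : IsOpen U) (h : ∀ z ∈ U, g z = g' z)
    {y : EuclideanSpace ℝ (Fin n)} (hy : y ∈ U) (k i j : Fin n) :
    christoffel g k i j y = christoffel g' k i j y := by
  have : ∀ a b l, partialDeriv a (fun z => g z b l) y = partialDeriv a (fun z => g' z b l) y :=
    fun a b l => vpartial_congr hU (fun z hz => by rw [h z hz]) hy a
  simp only [christoffel, this, h y hy]

theorem ricciCoord_congr {n : ℕ} {g g' : EuclideanSpace ℝ (Fin n) → Matrix (Fin n) (Fin n) ℝ}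
    {U : Set (EuclideanSpace ℝ (Fin n))} (hU : IsOpen U) (h : ∀ z ∈ U, g z = g' z)
    {y : EuclideanSpace ℝ (Fin n)} (hy : y ∈ U) (i j : Fin n) :
    ricciCoord g y i j = ricciCoord g' y i j := by
  have : ∀ a k b c, partialDeriv a (christoffel g k b c) y =
      partialDeriv a (christoffel g' k b c) y :=
    fun a k b c => vpartial_congr hU (fun z hz => christoffel_congr hU h hz k b c) hy a
  simp only [ricciCoord, this, christoffel_congr hU h hy]

/-! ### Spacelike immersions into the light cone -/

/-- `Ψ` is an immersion of the open set `U ⊆ ℝⁿ` into the light cone, with a timelike unit normal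
field `Φ` such that `⟨Φ, Ψ⟩ = -1`. -/
structure IsLightConeImmersion {n : ℕ} (U : Set (EuclideanSpace ℝ (Fin n)))
    (Ψ Φ : EuclideanSpace ℝ (Fin n) → MinkowskiSpace n) : Prop where
  isOpen : IsOpen U
  smooth : ContDiffOn ℝ ∞ Ψ U
  smooth_normal : ContDiffOn ℝ ∞ Φ U
  null : ∀ y ∈ U, lorentz (Ψ y) (Ψ y) = 0
  unit : ∀ y ∈ U, lorentz (Φ y) (Φ y) = -1
  transverse : ∀ y ∈ U, lorentz (Φ y) (Ψ y) = -1
  normal : ∀ y ∈ U, ∀ v, lorentz (Φ y) (fderiv ℝ Ψ y v) = 0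
  injective : ∀ y ∈ U, Function.Injective (fderiv ℝ Ψ y)

/-- The components `⟨∂ᵢ Ψ, ∂ⱼ Ψ⟩` of the induced metric. -/
def gram {n : ℕ} (Ψ : EuclideanSpace ℝ (Fin n) → MinkowskiSpace n) (y : EuclideanSpace ℝ (Fin n)) :
    Matrix (Fin n) (Fin n) ℝ :=
  Matrix.of fun i j => lorentz (vpartial i Ψ y) (vpartial j Ψ y)

theorem gram_apply {n : ℕ} (Ψ : EuclideanSpace ℝ (Fin n) → MinkowskiSpace n)
    (y : EuclideanSpace ℝ (Fin n)) (i j : Fin n) :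
    gram Ψ y i j = lorentz (vpartial i Ψ y) (vpartial j Ψ y) := rfl

theorem gram_comm {n : ℕ} (Ψ : EuclideanSpace ℝ (Fin n) → MinkowskiSpace n)
    (y : EuclideanSpace ℝ (Fin n)) (i j : Fin n) : gram Ψ y i j = gram Ψ y j i :=
  lorentz_comm _ _

/-- The components `⟨∂ᵢ Ψ, ∂ⱼ Φ⟩` of the second fundamental form in the direction of `-Φ`. -/
def mixedForm {n : ℕ} (Ψ Φ : EuclideanSpace ℝ (Fin n) → MinkowskiSpace n)
    (y : EuclideanSpace ℝ (Fin n)) (i j : Fin n) : ℝ :=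
  lorentz (vpartial i Ψ y) (vpartial j Φ y)

theorem lorentz_fderiv_fderiv_eq_sum {n : ℕ} (Ψ Φ : EuclideanSpace ℝ (Fin n) → MinkowskiSpace n)
    (y v w : EuclideanSpace ℝ (Fin n)) :
    lorentz (fderiv ℝ Ψ y v) (fderiv ℝ Φ y w) =
      ∑ i, ∑ j, lorentz (vpartial i Ψ y) (vpartial j Φ y) * v i * w j := by
  rw [fderiv_eq_sum_vpartial Ψ, fderiv_eq_sum_vpartial Φ, lorentz_sum_left]
  refine Finset.sum_congr rfl fun i _ => ?_
  rw [lorentz_smul_left, lorentz_sum_right, Finset.mul_sum]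
  refine Finset.sum_congr rfl fun j _ => ?_
  rw [lorentz_smul_right]
  ring

section Normal

variable {n : ℕ} {U : Set (EuclideanSpace ℝ (Fin n))}
  {Ψ Φ : EuclideanSpace ℝ (Fin n) → MinkowskiSpace n} {y : EuclideanSpace ℝ (Fin n)}

/-- Differentiate `⟨Φ, ∂ᵢΨ⟩ = 0` in direction `j`. Only normality is required, so that the pair `(φ,
η)` is covered as well as the light cone map with its normal `φ`. -/
theorem lorentz_vpartial_vpartial_of_normal (hU : IsOpen U) (hΨ : ContDiffOn ℝ ∞ Ψ U)
    (hΦ : ContDiffOn ℝ ∞ Φ U) (hn : ∀ z ∈ U, ∀ i, lorentz (Φ z) (vpartial i Ψ z) = 0)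
    (hy : y ∈ U) (i j : Fin n) :
    lorentz (Φ y) (vpartial j (vpartial i Ψ) y) = -mixedForm Ψ Φ y i j := by
  have h1 := vpartial_lorentz (hΦ.differentiableAt_of_isOpen hU hy)
    ((hΨ.vpartial hU i).differentiableAt_of_isOpen hU hy) j
  rw [vpartial_congr hU (g := fun _ => 0) (fun z hz => hn z hz i) hy,
    vpartial_const, lorentz_comm (vpartial j Φ y)] at h1
  rw [mixedForm]
  linarith

/-- The form is minus the `Φ`-component of the second derivatives of `Ψ`, and these commute. -/
theorem mixedForm_comm_of_normal (hU : IsOpen U) (hΨ : ContDiffOn ℝ ∞ Ψ U)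
    (hΦ : ContDiffOn ℝ ∞ Φ U) (hn : ∀ z ∈ U, ∀ i, lorentz (Φ z) (vpartial i Ψ z) = 0)
    (hy : y ∈ U) (i j : Fin n) : mixedForm Ψ Φ y i j = mixedForm Ψ Φ y j i := by
  have h1 := lorentz_vpartial_vpartial_of_normal hU hΨ hΦ hn hy i j
  have h2 := lorentz_vpartial_vpartial_of_normal hU hΨ hΦ hn hy j i
  rw [vpartial_comm hΨ hU hy] at h1
  linarith

end Normal

namespace IsLightConeImmersion

variable {n : ℕ} {U : Set (EuclideanSpace ℝ (Fin n))}
  {Ψ Φ : EuclideanSpace ℝ (Fin n) → MinkowskiSpace n} {y : EuclideanSpace ℝ (Fin n)}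

section
variable (h : IsLightConeImmersion U Ψ Φ) (hy : y ∈ U)
include h hy

theorem differentiableAt : DifferentiableAt ℝ Ψ y := h.smooth.differentiableAt_of_isOpen h.isOpen hy

theorem differentiableAt_normal : DifferentiableAt ℝ Φ y :=
  h.smooth_normal.differentiableAt_of_isOpen h.isOpen hy

theorem differentiableAt_vpartial (i : Fin n) : DifferentiableAt ℝ (vpartial i Ψ) y :=
  (h.smooth.vpartial h.isOpen i).differentiableAt_of_isOpen h.isOpen hy

theorem null_fderiv (v : EuclideanSpace ℝ (Fin n)) : lorentz (Ψ y) (fderiv ℝ Ψ y v) = 0 := by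
  have h1 := fderiv_lorentz_apply (h.differentiableAt hy) (h.differentiableAt hy) v
  have h2 : (fun z => lorentz (Ψ z) (Ψ z)) =ᶠ[𝓝 y] fun _ => 0 :=
    Filter.eventually_of_mem (h.isOpen.mem_nhds hy) h.null
  rw [h2.fderiv_eq, lorentz_comm (fderiv ℝ Ψ y v)] at h1
  simp at h1
  linarith

theorem null_vpartial (i : Fin n) : lorentz (Ψ y) (vpartial i Ψ y) = 0 := h.null_fderiv hy _

theorem normal_vpartial (i : Fin n) : lorentz (Φ y) (vpartial i Ψ y) = 0 := h.normal y hy _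

theorem null_vpartial_vpartial (i j : Fin n) :
    lorentz (Ψ y) (vpartial j (vpartial i Ψ) y) = -gram Ψ y i j := by
  have h1 := vpartial_lorentz (h.differentiableAt hy) (h.differentiableAt_vpartial hy i) j
  rw [vpartial_congr h.isOpen (g := fun _ => 0) (fun z hz => h.null_vpartial hz i) hy,
    vpartial_const, lorentz_comm (vpartial j Ψ y), ← gram_apply] at h1
  linarith

theorem normal_vpartial_vpartial (i j : Fin n) :
    lorentz (Φ y) (vpartial j (vpartial i Ψ) y) = -mixedForm Ψ Φ y i j :=
  lorentz_vpartial_vpartial_of_normal h.isOpen h.smooth h.smooth_normal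
    (fun _ hz i => h.normal_vpartial hz i) hy i j

theorem mixedForm_comm (i j : Fin n) : mixedForm Ψ Φ y i j = mixedForm Ψ Φ y j i :=
  mixedForm_comm_of_normal h.isOpen h.smooth h.smooth_normal
    (fun _ hz i => h.normal_vpartial hz i) hy i j

/-- A kernel vector of the Gram matrix yields a tangent vector that is isotropic and orthogonal to
the timelike `Φ`. Such a vector is zero, against injectivity of `dΨ`. -/
theorem det_gram_ne_zero : (gram Ψ y).det ≠ 0 := by
  intro hdet
  obtain ⟨v, hv, h0⟩ := Matrix.exists_mulVec_eq_zero_iff.2 hdet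
  set w : EuclideanSpace ℝ (Fin n) := WithLp.toLp 2 v with hw
  have h1 : ∀ i, lorentz (vpartial i Ψ y) (fderiv ℝ Ψ y w) = 0 := fun i => by
    have := congrFun h0 i
    simp only [Matrix.mulVec, dotProduct, gram_apply, Pi.zero_apply] at this
    rw [fderiv_eq_sum_vpartial, lorentz_sum_right, ← this]
    exact Finset.sum_congr rfl fun j _ => by rw [lorentz_smul_right, hw]; ring
  have h2 : lorentz (fderiv ℝ Ψ y w) (fderiv ℝ Ψ y w) = 0 := by
    conv_lhs => rw [fderiv_eq_sum_vpartial, lorentz_sum_left, ← fderiv_eq_sum_vpartial]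
    simp [lorentz_smul_left, h1]
  have h3 : fderiv ℝ Ψ y w = 0 := eq_zero_of_lorentz_self_eq_zero
    (by rw [h.unit y hy]; norm_num) (h.normal y hy w) h2
  have h4 : w = 0 := h.injective y hy (by rw [h3, map_zero])
  exact hv (by simpa [hw] using h4)

theorem sum_inv_gram_mul (i j : Fin n) :
    ∑ l, (gram Ψ y)⁻¹ i l * gram Ψ y l j = if i = j then 1 else 0 := by
  have := Matrix.nonsing_inv_mul (gram Ψ y) (h.det_gram_ne_zero hy).isUnit
  rw [← Matrix.mul_apply, this, Matrix.one_apply]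

theorem sum_gram_mul_inv (i j : Fin n) :
    ∑ l, gram Ψ y i l * (gram Ψ y)⁻¹ l j = if i = j then 1 else 0 := by
  have := Matrix.mul_nonsing_inv (gram Ψ y) (h.det_gram_ne_zero hy).isUnit
  rw [← Matrix.mul_apply, this, Matrix.one_apply]

theorem eq_zero_of_orthogonal {u : MinkowskiSpace n} (h0 : lorentz (Ψ y) u = 0)
    (h1 : lorentz (Φ y) u = 0) (h2 : ∀ i, lorentz (vpartial i Ψ y) u = 0) : u = 0 := by
  refine eq_zero_of_orthogonal_frame (by simp) (fderiv ℝ Ψ y).toLinearMap (h.injective y hy)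
    (h.unit y hy) (h.transverse y hy) (h.null y hy) (h.normal y hy) (h.null_fderiv hy) h1 h0
    fun v => ?_
  change lorentz (fderiv ℝ Ψ y v) u = 0
  simp [fderiv_eq_sum_vpartial, lorentz_sum_left, lorentz_smul_left, h2]

/-- The decomposition of a vector in the moving frame `∂₁ Ψ, …, ∂ₙ Ψ, Ψ, Φ`. -/
theorem frame_decomposition (u : MinkowskiSpace n) :
    u = (∑ k, (∑ l, (gram Ψ y)⁻¹ k l * lorentz u (vpartial l Ψ y)) • vpartial k Ψ y)
      + (lorentz (Ψ y) u - lorentz (Φ y) u) • Ψ y - lorentz (Ψ y) u • Φ y := by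
  -- The coefficients `a` of `Ψ` and `b` of `Φ` solve `⟨Ψ, u⟩ = -b` and `⟨Φ, u⟩ = -a - b`. It
  -- remains to see that the difference is orthogonal to the whole frame.
  rw [← sub_eq_zero]
  refine h.eq_zero_of_orthogonal hy ?_ ?_ fun i => ?_
  · simp [lorentz_sub_right, lorentz_add_right, lorentz_sum_right, lorentz_smul_right,
      h.null_vpartial hy, h.null y hy, lorentz_comm (Ψ y) (Φ y), h.transverse y hy]
  · simp [lorentz_sub_right, lorentz_add_right, lorentz_sum_right, lorentz_smul_right,
      h.normal_vpartial hy, h.unit y hy, h.transverse y hy]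
  · simp only [lorentz_sub_right, lorentz_add_right, lorentz_sum_right, lorentz_smul_right,
      lorentz_comm _ (Ψ y), lorentz_comm _ (Φ y), h.null_vpartial hy, h.normal_vpartial hy,
      ← gram_apply, Finset.sum_mul]
    rw [Finset.sum_comm]
    have : ∀ l, ∑ k, (gram Ψ y)⁻¹ k l * lorentz u (vpartial l Ψ y) * gram Ψ y i k
        = lorentz u (vpartial l Ψ y) * if i = l then 1 else 0 := fun l => by
      rw [← h.sum_gram_mul_inv hy i l, Finset.mul_sum]
      exact Finset.sum_congr rfl fun k _ => by ring
    rw [Finset.sum_congr rfl fun l _ => this l]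
    simp [lorentz_comm u]

/-- Parseval's identity in the moving frame. -/
theorem lorentz_self_eq (u : MinkowskiSpace n) :
    lorentz u u = (∑ k, ∑ l, (gram Ψ y)⁻¹ k l * lorentz u (vpartial k Ψ y)
      * lorentz u (vpartial l Ψ y)) + lorentz (Ψ y) u ^ 2
      - 2 * lorentz (Ψ y) u * lorentz (Φ y) u := by
  have h1 := congrArg (lorentz u) (h.frame_decomposition hy u)
  simp only [lorentz_sub_right, lorentz_add_right, lorentz_sum_right, lorentz_smul_right,
    Finset.sum_mul, lorentz_comm u (Ψ y), lorentz_comm u (Φ y)] at h1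
  rw [h1]
  have h2 : ∀ k l, (gram Ψ y)⁻¹ k l * lorentz u (vpartial l Ψ y) * lorentz u (vpartial k Ψ y) =
    (gram Ψ y)⁻¹ k l * lorentz u (vpartial k Ψ y) * lorentz u (vpartial l Ψ y) :=
    fun k l => by ring
  simp only [h2]
  ring

/-- The Christoffel symbols of the induced metric in terms of the second derivatives. -/
theorem christoffel_eq (k i j : Fin n) : christoffel (gram Ψ) k i j y =
    ∑ l, (gram Ψ y)⁻¹ k l * lorentz (vpartial j (vpartial i Ψ) y) (vpartial l Ψ y) := by
  have hd : ∀ a b c, partialDeriv a (fun z => gram Ψ z b c) y =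
      lorentz (vpartial a (vpartial b Ψ) y) (vpartial c Ψ y)
        + lorentz (vpartial a (vpartial c Ψ) y) (vpartial b Ψ y) := fun a b c => by
    rw [lorentz_comm (vpartial a (vpartial c Ψ) y)]
    exact vpartial_lorentz (h.differentiableAt_vpartial hy b) (h.differentiableAt_vpartial hy c) a
  have hc := fun a b => vpartial_comm h.smooth h.isOpen hy a b
  rw [christoffel, Finset.mul_sum]
  refine Finset.sum_congr rfl fun l _ => ?_
  -- Each of the three derivatives of the metric splits in two; commuting partial derivatives cancel
  -- four terms and identify the remaining two.
  rw [hd, hd, hd, hc i j, hc l i, hc l j]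
  ring

theorem christoffel_comm (k i j : Fin n) :
    christoffel (gram Ψ) k i j y = christoffel (gram Ψ) k j i y := by
  rw [h.christoffel_eq hy, h.christoffel_eq hy, vpartial_comm h.smooth h.isOpen hy]

/-- The formula of Gauss for the second derivatives of `Ψ`. -/
theorem vpartial_vpartial_eq (i j : Fin n) : vpartial j (vpartial i Ψ) y =
    (∑ k, christoffel (gram Ψ) k i j y • vpartial k Ψ y)
      + (mixedForm Ψ Φ y i j - gram Ψ y i j) • Ψ y + gram Ψ y i j • Φ y := by
  conv_lhs => rw [h.frame_decomposition hy (vpartial j (vpartial i Ψ) y)]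
  rw [h.null_vpartial_vpartial hy, h.normal_vpartial_vpartial hy, neg_smul, sub_neg_eq_add,
    neg_sub_neg]
  simp only [h.christoffel_eq hy]

theorem sum_gram_mul_raise (i j : Fin n) :
    ∑ l, gram Ψ y i l * ∑ p, (gram Ψ y)⁻¹ l p * mixedForm Ψ Φ y p j = mixedForm Ψ Φ y i j := by
  simp only [Finset.mul_sum, ← mul_assoc]
  rw [Finset.sum_comm]
  simp only [← Finset.sum_mul, h.sum_gram_mul_inv hy]
  simp

end

theorem contDiffOn_gram (h : IsLightConeImmersion U Ψ Φ) (i j : Fin n) :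
    ContDiffOn ℝ ∞ (fun z => gram Ψ z i j) U :=
  (h.smooth.vpartial h.isOpen i).lorentz (h.smooth.vpartial h.isOpen j)

theorem contDiffOn_christoffel (h : IsLightConeImmersion U Ψ Φ) (k i j : Fin n) :
    ContDiffOn ℝ ∞ (christoffel (gram Ψ) k i j) U := by
  refine ContDiffOn.congr ?_ fun z hz => h.christoffel_eq hz k i j
  refine ContDiffOn.sum fun l _ => ?_
  exact (contDiffOn_matrix_inv h.contDiffOn_gram (fun z hz => h.det_gram_ne_zero hz) k l).mul
    (((h.smooth.vpartial h.isOpen i).vpartial h.isOpen j).lorentz (h.smooth.vpartial h.isOpen l))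

theorem contDiffOn_mixedForm (h : IsLightConeImmersion U Ψ Φ) (i j : Fin n) :
    ContDiffOn ℝ ∞ (fun z => mixedForm Ψ Φ z i j) U :=
  (h.smooth.vpartial h.isOpen i).lorentz (h.smooth_normal.vpartial h.isOpen j)

section
variable (h : IsLightConeImmersion U Ψ Φ) (hy : y ∈ U)
include h hy

/-- The tangential components of the third derivatives of `Ψ`. -/
theorem tangential_third_derivative (i j m l : Fin n) :
    ∑ p, (gram Ψ y)⁻¹ l p * lorentz (vpartial m (vpartial j (vpartial i Ψ)) y) (vpartial p Ψ y) =
      partialDeriv m (christoffel (gram Ψ) l i j) y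
      + ∑ k, christoffel (gram Ψ) k i j y * christoffel (gram Ψ) l k m y
      + (mixedForm Ψ Φ y i j - gram Ψ y i j) * (if l = m then 1 else 0)
      + gram Ψ y i j * ∑ p, (gram Ψ y)⁻¹ l p * mixedForm Ψ Φ y p m := by
  have hΓ : ∀ k, DifferentiableAt ℝ (christoffel (gram Ψ) k i j) y := fun k =>
    (h.contDiffOn_christoffel k i j).differentiableAt_of_isOpen h.isOpen hy
  have hX : ∀ k, DifferentiableAt ℝ (vpartial k Ψ) y := h.differentiableAt_vpartial hy
  have hA : DifferentiableAt ℝ (fun z => mixedForm Ψ Φ z i j - gram Ψ z i j) y :=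
    ((h.contDiffOn_mixedForm i j).sub (h.contDiffOn_gram i j)).differentiableAt_of_isOpen
      h.isOpen hy
  have hG : DifferentiableAt ℝ (fun z => gram Ψ z i j) y :=
    (h.contDiffOn_gram i j).differentiableAt_of_isOpen h.isOpen hy
  -- The Gauss formula holds on all of `U` and may therefore be differentiated, here in direction
  -- `m`.
  have e := vpartial_congr h.isOpen (fun z hz => h.vpartial_vpartial_eq hz i j) hy m
  have hs : DifferentiableAt ℝ
      (fun z => ∑ k, christoffel (gram Ψ) k i j z • vpartial k Ψ z) y :=
    DifferentiableAt.fun_sum fun k _ => (hΓ k).smul (hX k)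
  have hAΨ : DifferentiableAt ℝ
      (fun z => (mixedForm Ψ Φ z i j - gram Ψ z i j) • Ψ z) y := hA.smul (h.differentiableAt hy)
  have hGΦ : DifferentiableAt ℝ (fun z => gram Ψ z i j • Φ z) y :=
    hG.smul (h.differentiableAt_normal hy)
  rw [vpartial_add (DifferentiableAt.fun_add hs hAΨ) hGΦ, vpartial_add hs hAΨ,
    vpartial_sum (f := fun k z => christoffel (gram Ψ) k i j z • vpartial k Ψ z)
      (fun k _ => (hΓ k).smul (hX k)), vpartial_smul hA (h.differentiableAt hy),
    vpartial_smul hG (h.differentiableAt_normal hy),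
    Finset.sum_congr rfl (fun k _ => vpartial_smul (hΓ k) (hX k) m)] at e
  -- Pairing with `w = gˡᵖ ∂ₚΨ` extracts the `l`-th tangential component; it kills `Ψ` and `Φ`.
  obtain ⟨w, hlin⟩ : ∃ w, ∀ u, lorentzForm n u w =
      ∑ p, (gram Ψ y)⁻¹ l p * lorentz u (vpartial p Ψ y) :=
    ⟨∑ p, (gram Ψ y)⁻¹ l p • vpartial p Ψ y, fun u => by simp [lorentzForm_apply]⟩
  have hδ : ∀ k, lorentzForm n (vpartial k Ψ y) w =
      if l = k then 1 else 0 := fun k => by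
    rw [hlin, ← h.sum_inv_gram_mul hy]
    exact Finset.sum_congr rfl fun p _ => by rw [gram_apply, lorentz_comm]
  have hΨ : lorentzForm n (Ψ y) w = 0 := by
    simp [hlin, h.null_vpartial hy]
  have hΦ : lorentzForm n (Φ y) w = 0 := by
    simp [hlin, h.normal_vpartial hy]
  have hΓ' : ∀ k, lorentzForm n (vpartial m (vpartial k Ψ) y) w = christoffel (gram Ψ) l k m y := fun k => by
    rw [hlin, h.christoffel_eq hy]
  have hT : lorentzForm n (vpartial m Φ y) w =
      ∑ p, (gram Ψ y)⁻¹ l p * mixedForm Ψ Φ y p m := by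
    rw [hlin]
    exact Finset.sum_congr rfl fun p _ => by rw [mixedForm, lorentz_comm]
  rw [← hlin, e]
  simp only [map_add, map_sum, map_smul, LinearMap.add_apply, LinearMap.smul_apply,
    LinearMap.sum_apply, hδ, hΨ, hΦ, hΓ', hT, smul_eq_mul, Finset.sum_add_distrib,
    partialDeriv_eq_vpartial]
  simp

/-- Contracted Gauss equation: the ambient space is flat, so the tangential parts of `∂ₗ∂ⱼ∂ᵢΨ` and
`∂ⱼ∂ₗ∂ᵢΨ` agree. Their Christoffel terms form the curvature of the induced metric, and the normal
terms give the right-hand side. -/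
theorem ricciCoord_gram (i j : Fin n) : ricciCoord (gram Ψ) y i j =
    (n - 1) * gram Ψ y i j - (n - 2) * mixedForm Ψ Φ y i j
      - gram Ψ y i j * ∑ l, ∑ p, (gram Ψ y)⁻¹ l p * mixedForm Ψ Φ y p l := by
  have hsymm : ∀ l, partialDeriv l (christoffel (gram Ψ) l i j) y
      - partialDeriv j (christoffel (gram Ψ) l i l) y
      + ∑ k, (christoffel (gram Ψ) k i j y * christoffel (gram Ψ) l k l y
        - christoffel (gram Ψ) k i l y * christoffel (gram Ψ) l k j y)
      = (mixedForm Ψ Φ y i l - gram Ψ y i l) * (if l = j then 1 else 0)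
      + gram Ψ y i l * (∑ p, (gram Ψ y)⁻¹ l p * mixedForm Ψ Φ y p j)
      - (mixedForm Ψ Φ y i j - gram Ψ y i j)
      - gram Ψ y i j * ∑ p, (gram Ψ y)⁻¹ l p * mixedForm Ψ Φ y p l := fun l => by
    have e1 := h.tangential_third_derivative hy i j l l
    have e2 := h.tangential_third_derivative hy i l j l
    rw [vpartial_comm (h.smooth.vpartial h.isOpen i) h.isOpen hy] at e1
    rw [if_pos rfl] at e1
    rw [Finset.sum_sub_distrib]
    linarith
  have e := Finset.sum_congr (rfl : (Finset.univ : Finset (Fin n)) = _) fun l _ => hsymm l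
  rw [Finset.sum_add_distrib, Finset.sum_sub_distrib, Finset.sum_sub_distrib,
    Finset.sum_sub_distrib, Finset.sum_add_distrib, h.sum_gram_mul_raise hy, ← Finset.mul_sum, Finset.sum_comm] at e
  rw [ricciCoord]
  -- The products in the definition of the Ricci curvature match those of `hsymm` after exchanging
  -- the summation indices and using the symmetry of the lower indices.
  have hc : ∑ k, ∑ l, (christoffel (gram Ψ) k k l y * christoffel (gram Ψ) l i j y
      - christoffel (gram Ψ) k j l y * christoffel (gram Ψ) l i k y) =
      ∑ l, ∑ k, (christoffel (gram Ψ) l i j y * christoffel (gram Ψ) k l k y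
        - christoffel (gram Ψ) l i k y * christoffel (gram Ψ) k l j y) := by
    rw [Finset.sum_comm]
    refine Finset.sum_congr rfl fun l _ => Finset.sum_congr rfl fun k _ => ?_
    rw [h.christoffel_comm hy k k l, h.christoffel_comm hy k j l]
    ring
  rw [hc, Finset.sum_sub_distrib]
  simp at e ⊢
  linarith

/-- The Schouten tensor of the induced metric, in coordinates. -/
theorem schouten_gram (hn : 2 < n) (i j : Fin n) :
    1 / ((n : ℝ) - 2) * (ricciCoord (gram Ψ) y i j
      - (∑ a, ∑ b, (gram Ψ y)⁻¹ a b * ricciCoord (gram Ψ) y a b) / (2 * ((n : ℝ) - 1))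
        * gram Ψ y i j) = 1 / 2 * gram Ψ y i j - mixedForm Ψ Φ y i j := by
  have hn' : (2 : ℝ) < n := by exact_mod_cast hn
  set t := ∑ l, ∑ p, (gram Ψ y)⁻¹ l p * mixedForm Ψ Φ y p l with ht
  have h1 : ∑ a, ∑ b, (gram Ψ y)⁻¹ a b * gram Ψ y a b = n := by
    have : ∀ a, ∑ b, (gram Ψ y)⁻¹ a b * gram Ψ y a b = 1 := fun a => by
      refine Eq.trans ?_ ((h.sum_inv_gram_mul hy a a).trans (if_pos rfl))
      exact Finset.sum_congr rfl fun b _ => by rw [gram_comm Ψ y a b]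
    simp [this]
  have h2 : ∑ a, ∑ b, (gram Ψ y)⁻¹ a b * mixedForm Ψ Φ y a b = t := by
    refine Finset.sum_congr rfl fun a _ => Finset.sum_congr rfl fun b _ => ?_
    rw [h.mixedForm_comm hy]
  -- The metric has trace `n` and the mixed form trace `t`, so the scalar curvature is `n (n - 1 -
  -- t) - (n - 2) t`.
  have hS : ∑ a, ∑ b, (gram Ψ y)⁻¹ a b * ricciCoord (gram Ψ) y a b
      = (n - 1) * (n - 2 * t) := by
    have : ∀ a b, (gram Ψ y)⁻¹ a b * ricciCoord (gram Ψ) y a b =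
        (n - 1 - t) * ((gram Ψ y)⁻¹ a b * gram Ψ y a b)
          - (n - 2) * ((gram Ψ y)⁻¹ a b * mixedForm Ψ Φ y a b) := fun a b => by
      rw [h.ricciCoord_gram hy, ← ht]; ring
    simp only [this, Finset.sum_sub_distrib, ← Finset.mul_sum, h1, h2]
    ring
  rw [hS, h.ricciCoord_gram hy, ← ht]
  have e1 : (n : ℝ) - 2 ≠ 0 := by linarith
  have e2 : (n : ℝ) - 1 ≠ 0 := by linarith
  field_simp
  ring

end

end IsLightConeImmersion

/-! ### The section of the light cone at height one -/

/-- The point `(1, 0)` of hyperbolic space. -/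
def hyperbolicOrigin (n : ℕ) : MinkowskiSpace n := (1, 0)

theorem lorentz_hyperbolicOrigin {n : ℕ} (p : MinkowskiSpace n) :
    lorentz (hyperbolicOrigin n) p = -p.1 := by
  simp [lorentz, hyperbolicOrigin]

/-- The projection of a map into the light cone to height one. -/
def normalizedHeight {X : Type*} {n : ℕ} (Ψ : X → MinkowskiSpace n) (y : X) : MinkowskiSpace n :=
  (Ψ y).1⁻¹ • Ψ y

/-- The logarithm of the height of a map into Minkowski space. -/
def logHeight {X : Type*} {n : ℕ} (Ψ : X → MinkowskiSpace n) (y : X) : ℝ := Real.log (Ψ y).1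

namespace IsLightConeImmersion

variable {n : ℕ} {U : Set (EuclideanSpace ℝ (Fin n))}
  {Ψ Φ : EuclideanSpace ℝ (Fin n) → MinkowskiSpace n} {y : EuclideanSpace ℝ (Fin n)}

variable (h : IsLightConeImmersion U Ψ Φ) (hpos : ∀ y ∈ U, 0 < (Ψ y).1)
include h hpos

theorem contDiffOn_height_inv : ContDiffOn ℝ ∞ (fun z => (Ψ z).1⁻¹) U :=
  (contDiff_fst.comp_contDiffOn h.smooth).inv fun z hz => (hpos z hz).ne'

theorem contDiffOn_logHeight : ContDiffOn ℝ ∞ (logHeight Ψ) U :=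
  (contDiff_fst.comp_contDiffOn h.smooth).log fun z hz => (hpos z hz).ne'

theorem vpartial_height_inv (hy : y ∈ U) (i : Fin n) :
    vpartial i (fun z => (Ψ z).1⁻¹) y = -((Ψ y).1⁻¹ * vpartial i (logHeight Ψ) y) := by
  have hd : DifferentiableAt ℝ (fun z => (Ψ z).1) y := (h.differentiableAt hy).fst
  have h0 := (hpos y hy).ne'
  have e1 : vpartial i (logHeight Ψ) y = (Ψ y).1⁻¹ * vpartial i (fun z => (Ψ z).1) y := by
    have := (hd.hasFDerivAt.log h0).fderiv
    change fderiv ℝ (fun z => Real.log (Ψ z).1) y _ = _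
    rw [this]; rfl
  have e2 : vpartial i (fun z => (Ψ z).1⁻¹) y =
      -(((Ψ y).1 ^ 2)⁻¹ * vpartial i (fun z => (Ψ z).1) y) := by
    have := ((hasDerivAt_inv h0).comp_hasFDerivAt y hd.hasFDerivAt).fderiv
    change fderiv ℝ (Inv.inv ∘ fun z => (Ψ z).1) y _ = _
    rw [this]; simp [vpartial]
  rw [e1, e2]
  ring

theorem fderiv_normalizedHeight (hy : y ∈ U) (v : EuclideanSpace ℝ (Fin n)) :
    fderiv ℝ (normalizedHeight Ψ) y v =
      fderiv ℝ (fun z => (Ψ z).1⁻¹) y v • Ψ y + (Ψ y).1⁻¹ • fderiv ℝ Ψ y v := by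
  have hc := (h.contDiffOn_height_inv hpos).differentiableAt_of_isOpen h.isOpen hy
  change fderiv ℝ (fun z => (Ψ z).1⁻¹ • Ψ z) y v = _
  rw [fderiv_fun_smul hc (h.differentiableAt hy)]
  simp [add_comm]

/-- The normalization of an immersion into the light cone is again one. -/
theorem isLightConeImmersion_normalizedHeight :
    IsLightConeImmersion U (normalizedHeight Ψ) fun _ => hyperbolicOrigin n := by
  have hs : ContDiffOn ℝ ∞ (normalizedHeight Ψ) U :=
    (h.contDiffOn_height_inv hpos).smul h.smooth
  have ht : ∀ z ∈ U, lorentz (hyperbolicOrigin n) (normalizedHeight Ψ z) = -1 :=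
    fun z hz => by
      rw [lorentz_hyperbolicOrigin]
      simp [normalizedHeight, (hpos z hz).ne']
  refine ⟨h.isOpen, hs, contDiffOn_const, fun z hz => ?_, fun z hz => ?_, ht,
    fun z hz v => ?_, fun z hz => ?_⟩
  · simp [normalizedHeight, lorentz_smul_left, lorentz_smul_right, h.null z hz]
  · rw [lorentz_hyperbolicOrigin]; simp [hyperbolicOrigin]
  · have h1 := fderiv_lorentz_apply (differentiableAt_const (hyperbolicOrigin n))
      (hs.differentiableAt_of_isOpen h.isOpen hz) v
    have h2 : (fun z => lorentz (hyperbolicOrigin n) (normalizedHeight Ψ z))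
        =ᶠ[𝓝 z] fun _ => -1 := Filter.eventually_of_mem (h.isOpen.mem_nhds hz) ht
    rw [h2.fderiv_eq] at h1
    simpa [lorentz_zero_left] using h1.symm
  · rw [injective_iff_map_eq_zero]
    intro v hv
    rw [h.fderiv_normalizedHeight hpos hz] at hv
    -- As `Φ` is orthogonal to `dΨ` and `⟨Φ, Ψ⟩ = -1`, pairing with `Φ` leaves only the derivative
    -- of the scaling factor.
    have h1 := congrArg (lorentz (Φ z)) hv
    simp only [lorentz_add_right, lorentz_smul_right, h.transverse z hz, h.normal z hz,
      lorentz_zero_right] at h1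
    have h2 : fderiv ℝ (fun z => (Ψ z).1⁻¹) z v = 0 := by linarith
    rw [h2, zero_smul, zero_add, smul_eq_zero_iff_right (inv_ne_zero (hpos z hz).ne')] at hv
    exact h.injective z hz (by rw [hv, map_zero])

/-- Conformality: the derivative of the scaling factor multiplies `Ψ`, which is null and orthogonal
to `dΨ`, so it does not contribute. -/
theorem lorentz_fderiv_normalizedHeight (hy : y ∈ U) (v w : EuclideanSpace ℝ (Fin n)) :
    lorentz (fderiv ℝ (normalizedHeight Ψ) y v) (fderiv ℝ (normalizedHeight Ψ) y w) =
      (Ψ y).1⁻¹ ^ 2 * lorentz (fderiv ℝ Ψ y v) (fderiv ℝ Ψ y w) := by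
  rw [h.fderiv_normalizedHeight hpos hy, h.fderiv_normalizedHeight hpos hy]
  simp only [lorentz_add_right, lorentz_smul_right, lorentz_add_left, lorentz_smul_left,
    h.null y hy, h.null_fderiv hy, lorentz_comm _ (Ψ y)]
  ring

theorem gram_normalizedHeight (hy : y ∈ U) (i j : Fin n) :
    gram (normalizedHeight Ψ) y i j = (Ψ y).1⁻¹ ^ 2 * gram Ψ y i j :=
  h.lorentz_fderiv_normalizedHeight hpos hy _ _

/-- This is where `dρ` enters: pairing with `Φ` sees minus the derivative of the scaling factor
`e^{-ρ}`. -/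
theorem normal_vpartial_normalizedHeight (hy : y ∈ U) (i : Fin n) :
    lorentz (Φ y) (vpartial i (normalizedHeight Ψ) y) =
      (Ψ y).1⁻¹ * vpartial i (logHeight Ψ) y := by
  have := h.vpartial_height_inv hpos hy i
  rw [vpartial] at this
  rw [vpartial, h.fderiv_normalizedHeight hpos hy]
  simp only [lorentz_add_right, lorentz_smul_right, h.transverse y hy, h.normal y hy, this]
  ring

/-- Differentiating `⟨Φ, Ψ⟩ = -1` gives `⟨∂ⱼΦ, Ψ⟩ = 0`, so the derivative of the scaling factor
drops out. -/
theorem vpartial_normalizedHeight_vpartial_normal (hy : y ∈ U) (i j : Fin n) :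
    lorentz (vpartial i (normalizedHeight Ψ) y) (vpartial j Φ y) =
      (Ψ y).1⁻¹ * mixedForm Ψ Φ y i j := by
  have h1 := vpartial_lorentz (h.differentiableAt_normal hy) (h.differentiableAt hy) j
  rw [vpartial_congr h.isOpen (g := fun _ => -1) (fun z hz => h.transverse z hz) hy,
    vpartial_const, h.normal_vpartial hy, add_zero, lorentz_comm] at h1
  rw [vpartial, h.fderiv_normalizedHeight hpos hy]
  rw [lorentz_add_left, lorentz_smul_left, ← h1, lorentz_smul_left, mul_zero, zero_add]
  rfl

/-- The conformal form of the Schouten tensor, in coordinates. -/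
theorem conformalSchouten_gram (hy : y ∈ U) (i j : Fin n) :
    -hessianCoord (gram (normalizedHeight Ψ)) (logHeight Ψ) y i j
      + partialDeriv i (logHeight Ψ) y * partialDeriv j (logHeight Ψ) y
      - 1 / 2 * (-1 + ∑ a, ∑ b, (gram (normalizedHeight Ψ) y)⁻¹ a b
        * partialDeriv a (logHeight Ψ) y * partialDeriv b (logHeight Ψ) y)
        * gram (normalizedHeight Ψ) y i j
      = 1 / 2 * gram Ψ y i j - mixedForm Ψ Φ y i j := by
  have hN := h.isLightConeImmersion_normalizedHeight hpos
  have hc0 : (Ψ y).1⁻¹ ≠ 0 := inv_ne_zero (hpos y hy).ne'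
  have hcd := (h.contDiffOn_height_inv hpos).differentiableAt_of_isOpen h.isOpen hy
  have hrd := ((h.contDiffOn_logHeight hpos).vpartial h.isOpen i).differentiableAt_of_isOpen
    h.isOpen hy
  have hg := h.gram_normalizedHeight hpos hy i j
  have hΦN : lorentz (Φ y) (normalizedHeight Ψ y) = -(Ψ y).1⁻¹ := by
    simp [normalizedHeight, lorentz_smul_right, h.transverse y hy]
  have hmixed : mixedForm (normalizedHeight Ψ) (fun _ => hyperbolicOrigin n) y i j = 0 := by
    rw [mixedForm, vpartial_const, lorentz_zero_right]
  -- Write `N` for the normalized map. Parseval for `Φ` in the frame of `N`, with `⟨Φ, Φ⟩ = -1`,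
  -- expresses the height of `Φ` by `‖∇ρ‖²`. The Gauss formula of `N` paired with `Φ`, and the
  -- derivative of `⟨Φ, ∂ᵢN⟩ = e^{-ρ} ∂ᵢρ`, bring in the Hessian of `ρ`.
  have hpars := hN.lorentz_self_eq hy (Φ y)
  have hgauss := congrArg (lorentz (Φ y)) (hN.vpartial_vpartial_eq hy i j)
  have hdiff := vpartial_lorentz (h.differentiableAt_normal hy)
    (hN.differentiableAt_vpartial hy i) j
  rw [vpartial_congr h.isOpen (fun z hz => h.normal_vpartial_normalizedHeight hpos hz i) hy,
    lorentz_comm (vpartial j Φ y), h.vpartial_normalizedHeight_vpartial_normal hpos hy,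
    hgauss] at hdiff
  have hprod := vpartial_smul hcd hrd j
  simp only [smul_eq_mul] at hprod
  rw [hprod, h.vpartial_height_inv hpos hy] at hdiff
  simp only [lorentz_add_right, lorentz_sum_right, lorentz_smul_right, hmixed,
    h.normal_vpartial_normalizedHeight hpos hy, hΦN, lorentz_comm (Φ y) (hyperbolicOrigin n),
    lorentz_hyperbolicOrigin] at hdiff
  rw [lorentz_comm (normalizedHeight Ψ y), hΦN, h.unit y hy, lorentz_hyperbolicOrigin]
    at hpars
  simp only [h.normal_vpartial_normalizedHeight hpos hy] at hpars
  have hS : ∑ k, ∑ l, (gram (normalizedHeight Ψ) y)⁻¹ k l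
      * ((Ψ y).1⁻¹ * vpartial k (logHeight Ψ) y) * ((Ψ y).1⁻¹ * vpartial l (logHeight Ψ) y)
      = (Ψ y).1⁻¹ ^ 2 * ∑ k, ∑ l, (gram (normalizedHeight Ψ) y)⁻¹ k l
      * vpartial k (logHeight Ψ) y * vpartial l (logHeight Ψ) y := by
    simp only [Finset.mul_sum]
    exact Finset.sum_congr rfl fun k _ => Finset.sum_congr rfl fun l _ => by ring
  have hΓ : ∑ k, christoffel (gram (normalizedHeight Ψ)) k i j y
      * ((Ψ y).1⁻¹ * vpartial k (logHeight Ψ) y) = (Ψ y).1⁻¹ *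
      ∑ k, christoffel (gram (normalizedHeight Ψ)) k i j y
        * vpartial k (logHeight Ψ) y := by
    rw [Finset.mul_sum]
    exact Finset.sum_congr rfl fun k _ => by ring
  rw [hS] at hpars
  rw [hΓ] at hdiff
  simp only [hessianCoord, partialDeriv_eq_vpartial]
  rw [vpartial_comm (h.contDiffOn_logHeight hpos) h.isOpen hy i j]
  generalize (Ψ y).1⁻¹ = c at *
  generalize (∑ k, ∑ l, (gram (normalizedHeight Ψ) y)⁻¹ k l
      * vpartial k (logHeight Ψ) y * vpartial l (logHeight Ψ) y) = G at *
  generalize (∑ k, christoffel (gram (normalizedHeight Ψ)) k i j y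
        * vpartial k (logHeight Ψ) y) = S at *
  generalize gram (normalizedHeight Ψ) y i j = a at *
  generalize gram Ψ y i j = b at *
  generalize mixedForm Ψ Φ y i j = T at *
  generalize vpartial j (vpartial i (logHeight Ψ)) y = D at *
  generalize vpartial i (logHeight Ψ) y = r at *
  generalize vpartial j (logHeight Ψ) y = s at *
  generalize (Φ y).1 = f at *
  subst hg
  -- With `c = e^{-ρ}`, after multiplication by `2c` the identity is polynomial; `hpars` eliminates
  -- the height `f` of `Φ`.
  apply mul_left_cancel₀ (mul_ne_zero hc0 two_ne_zero)
  linear_combination -2 * hdiff + c * b * hpars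
end IsLightConeImmersion

/-! ### Expressions in the preferred charts -/

section Charts

variable {n : ℕ} {M : Type*} [TopologicalSpace M] [ChartedSpace (EuclideanSpace ℝ (Fin n)) M]
  [IsManifold (𝓡 n) ∞ M] {F : Type*} [NormedAddCommGroup F] [NormedSpace ℝ F] {f : M → F}

theorem ContMDiff.contDiffOn_comp_extChartAt_symm (hf : ContMDiff (𝓡 n) 𝓘(ℝ, F) ∞ f) (x : M) :
    ContDiffOn ℝ ∞ (f ∘ (extChartAt (𝓡 n) x).symm) (extChartAt (𝓡 n) x).target := by
  rw [← contMDiffOn_iff_contDiffOn]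
  exact hf.comp_contMDiffOn (contMDiffOn_extChartAt_symm x)

theorem mdifferentiableAt_extChartAt_symm {x : M} {y : EuclideanSpace ℝ (Fin n)}
    (hy : y ∈ (extChartAt (𝓡 n) x).target) :
    MDifferentiableAt 𝓘(ℝ, EuclideanSpace ℝ (Fin n)) (𝓡 n) (extChartAt (𝓡 n) x).symm y :=
  have : IsManifold (𝓡 n) 1 M := IsManifold.of_le (n := ∞) (by simp)
  ((contMDiffOn_extChartAt_symm (n := 1) x).mdifferentiableOn one_ne_zero y
    hy).mdifferentiableAt ((isOpen_extChartAt_target x).mem_nhds hy)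

theorem fderiv_comp_extChartAt_symm (hf : ContMDiff (𝓡 n) 𝓘(ℝ, F) ∞ f) {x : M}
    {y : EuclideanSpace ℝ (Fin n)} (hy : y ∈ (extChartAt (𝓡 n) x).target)
    (v : EuclideanSpace ℝ (Fin n)) :
    fderiv ℝ (f ∘ (extChartAt (𝓡 n) x).symm) y v =
      mvfderiv (𝓡 n) f ((extChartAt (𝓡 n) x).symm y)
        (mfderiv 𝓘(ℝ, EuclideanSpace ℝ (Fin n)) (𝓡 n) (extChartAt (𝓡 n) x).symm y v) := by
  rw [← mfderiv_eq_fderiv, mfderiv_comp y (hf.mdifferentiableAt (by simp))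
    (mdifferentiableAt_extChartAt_symm hy)]
  rfl

theorem vpartial_comp_extChartAt_symm (hf : ContMDiff (𝓡 n) 𝓘(ℝ, F) ∞ f) {x : M}
    {y : EuclideanSpace ℝ (Fin n)} (hy : y ∈ (extChartAt (𝓡 n) x).target) (i : Fin n) :
    vpartial i (f ∘ (extChartAt (𝓡 n) x).symm) y =
      mvfderiv (𝓡 n) f ((extChartAt (𝓡 n) x).symm y) (coordVector x i y) :=
  fderiv_comp_extChartAt_symm hf hy _

/-- Chain rule for `f = (f ∘ chart⁻¹) ∘ chart` near `x`. It moves every form `⟨dα, dβ⟩` at `x` into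
coordinates. -/
theorem mvfderiv_eq_fderiv_comp_extChartAt_symm (hf : ContMDiff (𝓡 n) 𝓘(ℝ, F) ∞ f) (x : M)
    (v : TangentSpace (𝓡 n) x) :
    mvfderiv (𝓡 n) f x v =
      fderiv ℝ (f ∘ (extChartAt (𝓡 n) x).symm) (extChartAt (𝓡 n) x x) (vectorCoord x v) := by
  have : IsManifold (𝓡 n) 1 M := IsManifold.of_le (n := ∞) (by simp)
  have hx := mem_extChartAt_target (I := 𝓡 n) x
  have hd : DifferentiableAt ℝ (f ∘ (extChartAt (𝓡 n) x).symm) (extChartAt (𝓡 n) x x) :=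
    (hf.contDiffOn_comp_extChartAt_symm x).differentiableAt_of_isOpen
      (isOpen_extChartAt_target x) hx
  have hc : MDifferentiableAt (𝓡 n) 𝓘(ℝ, EuclideanSpace ℝ (Fin n)) (extChartAt (𝓡 n) x) x :=
    mdifferentiableAt_extChartAt (mem_chart_source _ x)
  have he : f =ᶠ[𝓝 x] (f ∘ (extChartAt (𝓡 n) x).symm) ∘ extChartAt (𝓡 n) x := by
    filter_upwards [extChartAt_source_mem_nhds (I := 𝓡 n) x] with z hz
    exact congrArg f ((extChartAt (𝓡 n) x).left_inv hz).symm
  have h1 : mfderiv (𝓡 n) 𝓘(ℝ, F) f x =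
      (mfderiv 𝓘(ℝ, EuclideanSpace ℝ (Fin n)) 𝓘(ℝ, F) (f ∘ (extChartAt (𝓡 n) x).symm)
        (extChartAt (𝓡 n) x x)).comp
      (mfderiv (𝓡 n) 𝓘(ℝ, EuclideanSpace ℝ (Fin n)) (extChartAt (𝓡 n) x) x) := by
    rw [← mfderiv_comp x hd.mdifferentiableAt hc]
    exact he.mfderiv_eq
  change mfderiv (𝓡 n) 𝓘(ℝ, F) f x v = _
  rw [h1, mfderiv_eq_fderiv]
  rfl

theorem mfderiv_extChartAt_symm_injective {x : M} {y : EuclideanSpace ℝ (Fin n)}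
    (hy : y ∈ (extChartAt (𝓡 n) x).target) : Function.Injective
      (mfderiv 𝓘(ℝ, EuclideanSpace ℝ (Fin n)) (𝓡 n) (extChartAt (𝓡 n) x).symm y) := by
  have : IsManifold (𝓡 n) 1 M := IsManifold.of_le (n := ∞) (by simp)
  have := (isInvertible_mfderivWithin_extChartAt_symm (I := 𝓡 n) hy).injective
  rwa [show Set.range (𝓡 n) = Set.univ from (𝓡 n).range_eq_univ, mfderivWithin_univ] at this

end Charts

/-! ### The light cone map of an oriented hypersurface -/

/-- Were `q.1 ≤ 0`, then `q` would lie in the closed cone opposite to `p`, and Cauchy–Schwarz would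
give `⟨p, q⟩ ≥ 0`. -/
theorem height_pos_of_null {n : ℕ} {p q : MinkowskiSpace n} (hp : p ∈ hyperbolicSpace n)
    (hq : lorentz q q = 0) (hpq : lorentz p q = -1) : 0 < q.1 := by
  obtain ⟨hpp, hp0⟩ := hp
  by_contra hneg
  have hcs := abs_real_inner_le_norm p.2 q.2
  simp only [lorentz, real_inner_self_eq_norm_sq] at hpp hq hpq
  have h1 : ‖p.2‖ ≤ p.1 := abs_le_of_sq_le_sq' (by nlinarith) hp0.le |>.2
  have h2 : ‖q.2‖ ≤ -q.1 := abs_le_of_sq_le_sq' (by nlinarith) (by linarith) |>.2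
  have h3 : ‖p.2‖ * ‖q.2‖ ≤ p.1 * -q.1 := mul_le_mul h1 h2 (norm_nonneg _) hp0.le
  have h4 := neg_abs_le (inner ℝ p.2 q.2)
  linarith

section Hypersurface

variable {n : ℕ} {M : Type*} [TopologicalSpace M] [ChartedSpace (EuclideanSpace ℝ (Fin n)) M]
  {φ η : M → MinkowskiSpace n}

theorem lorentz_lightConeMap_self (hφ : IsImmersedHypersurface φ) (hη : IsUnitNormal φ η) (x : M) :
    lorentz (lightConeMap φ η x) (lightConeMap φ η x) = 0 := by
  simp only [lightConeMap, lorentz_add_left, lorentz_add_right, (hφ.mem_hyperbolicSpace x).1,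
    hη.unit, hη.tangent, lorentz_comm (φ x) (η x)]
  ring

theorem lorentz_lightConeMap (hφ : IsImmersedHypersurface φ) (hη : IsUnitNormal φ η) (x : M) :
    lorentz (φ x) (lightConeMap φ η x) = -1 := by
  simp only [lightConeMap, lorentz_add_right, (hφ.mem_hyperbolicSpace x).1,
    hη.tangent, lorentz_comm (φ x) (η x)]
  ring

theorem lightConeMap_height_pos (hφ : IsImmersedHypersurface φ) (hη : IsUnitNormal φ η) (x : M) :
    0 < (lightConeMap φ η x).1 :=
  height_pos_of_null (hφ.mem_hyperbolicSpace x) (lorentz_lightConeMap_self hφ hη x)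
    (lorentz_lightConeMap hφ hη x)

theorem contMDiff_lightConeMap (hφ : IsImmersedHypersurface φ) (hη : IsUnitNormal φ η) :
    ContMDiff (𝓡 n) 𝓘(ℝ, MinkowskiSpace n) ∞ (lightConeMap φ η) :=
  hφ.smooth.add hη.smooth

theorem mvfderiv_lightConeMap (hφ : IsImmersedHypersurface φ) (hη : IsUnitNormal φ η) (x : M)
    (v : TangentSpace (𝓡 n) x) : mvfderiv (𝓡 n) (lightConeMap φ η) x v =
      mvfderiv (𝓡 n) φ x v + mvfderiv (𝓡 n) η x v := by
  have := mvfderiv_add (hφ.smooth.mdifferentiableAt (x := x) (by simp))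
    (hη.smooth.mdifferentiableAt (x := x) (by simp))
  change mvfderiv (𝓡 n) (φ + η) x v = _
  rw [this]; rfl

theorem contMDiff_normalizedHeight_lightConeMap (hφ : IsImmersedHypersurface φ)
    (hη : IsUnitNormal φ η) :
    ContMDiff (𝓡 n) 𝓘(ℝ, MinkowskiSpace n) ∞ (normalizedHeight (lightConeMap φ η)) := by
  have h1 : ContMDiff (𝓡 n) 𝓘(ℝ, ℝ) ∞ fun x => (lightConeMap φ η x).1 :=
    (contDiff_fst (𝕜 := ℝ)).contMDiff.comp (contMDiff_lightConeMap hφ hη)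
  have h2 : ContMDiff (𝓡 n) 𝓘(ℝ, ℝ) ∞ fun x => ((lightConeMap φ η x).1)⁻¹ := fun x =>
    ((contDiffAt_inv ℝ (lightConeMap_height_pos hφ hη x).ne').contMDiffAt).comp x (h1 x)
  exact h2.smul (contMDiff_lightConeMap hφ hη)

variable [IsManifold (𝓡 n) ∞ M]

/-- The second fundamental form is symmetric. -/
theorem secondFundamentalForm_comm (hφ : IsImmersedHypersurface φ) (hη : IsUnitNormal φ η) (x : M)
    (v w : TangentSpace (𝓡 n) x) :
    secondFundamentalForm φ η x v w = secondFundamentalForm φ η x w v := by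
  have hx := mem_extChartAt_target (I := 𝓡 n) x
  have hs : ∀ i j, mixedForm (φ ∘ (extChartAt (𝓡 n) x).symm) (η ∘ (extChartAt (𝓡 n) x).symm)
      (extChartAt (𝓡 n) x x) i j = mixedForm (φ ∘ (extChartAt (𝓡 n) x).symm)
      (η ∘ (extChartAt (𝓡 n) x).symm) (extChartAt (𝓡 n) x x) j i := fun i j =>
    mixedForm_comm_of_normal (isOpen_extChartAt_target x)
      (hφ.smooth.contDiffOn_comp_extChartAt_symm x) (hη.smooth.contDiffOn_comp_extChartAt_symm x)
      (fun z hz i => by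
        rw [vpartial_comp_extChartAt_symm hφ.smooth hz]
        exact hη.normal _ _) hx i j
  rw [secondFundamentalForm, secondFundamentalForm]
  simp only [mvfderiv_eq_fderiv_comp_extChartAt_symm hφ.smooth,
    mvfderiv_eq_fderiv_comp_extChartAt_symm hη.smooth, lorentz_fderiv_fderiv_eq_sum]
  rw [Finset.sum_comm]
  congr 1
  refine Finset.sum_congr rfl fun i _ => Finset.sum_congr rfl fun j _ => ?_
  have := hs i j
  simp only [mixedForm] at this
  rw [this]
  ring

/-- For a canonically oriented hypersurface the light cone map is an immersion. -/
theorem mvfderiv_lightConeMap_injective (hφ : IsImmersedHypersurface φ)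
    (hη : IsCanonicalOrientation φ η) (x : M) :
    Function.Injective (mvfderiv (𝓡 n) (lightConeMap φ η) x) := by
  rw [injective_iff_map_eq_zero]
  intro v hv
  by_contra hv0
  -- If `dψ(v) = 0`, then `dη(v) = -dφ(v)`, so `v` would be a principal direction with curvature
  -- `1`.
  refine lt_irrefl (1 : ℝ) (hη.2 x 1 v ⟨hv0, fun w => ?_⟩)
  rw [mvfderiv_lightConeMap hφ hη.1] at hv
  rw [secondFundamentalForm_comm hφ hη.1, secondFundamentalForm, firstFundamentalForm,
    eq_neg_of_add_eq_zero_right hv, lorentz_neg_right, neg_neg, one_mul, lorentz_comm]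

/-- The light cone map in the preferred chart at a point. -/
theorem isLightConeImmersion_lightConeMap (hφ : IsImmersedHypersurface φ)
    (hη : IsCanonicalOrientation φ η) (x : M) :
    IsLightConeImmersion (extChartAt (𝓡 n) x).target
      (lightConeMap φ η ∘ (extChartAt (𝓡 n) x).symm) (φ ∘ (extChartAt (𝓡 n) x).symm) := by
  have hU := isOpen_extChartAt_target (I := 𝓡 n) x
  have hΦ := hφ.smooth.contDiffOn_comp_extChartAt_symm x
  have hH := hη.1.smooth.contDiffOn_comp_extChartAt_symm x
  have hψ := contMDiff_lightConeMap hφ hη.1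
  refine ⟨hU, hψ.contDiffOn_comp_extChartAt_symm x, hΦ,
    fun y _ => lorentz_lightConeMap_self hφ hη.1 _, fun y _ => (hφ.mem_hyperbolicSpace _).1,
    fun y _ => lorentz_lightConeMap hφ hη.1 _, fun y hy v => ?_, fun y hy => ?_⟩
  -- `φ` is orthogonal to `dφ` because `⟨φ, φ⟩` is constant, and to `dη` because `⟨φ, η⟩ = 0` and
  -- `⟨dφ, η⟩ = 0`.
  · have dΦ := hΦ.differentiableAt_of_isOpen hU hy
    have dH := hH.differentiableAt_of_isOpen hU hy
    have e1 := fderiv_lorentz_apply dΦ dΦ v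
    have e2 := fderiv_lorentz_apply dΦ dH v
    have f1 : (fun z => lorentz ((φ ∘ (extChartAt (𝓡 n) x).symm) z)
        ((φ ∘ (extChartAt (𝓡 n) x).symm) z)) = fun _ => -1 :=
      funext fun z => (hφ.mem_hyperbolicSpace _).1
    have f2 : (fun z => lorentz ((φ ∘ (extChartAt (𝓡 n) x).symm) z)
        ((η ∘ (extChartAt (𝓡 n) x).symm) z)) = fun _ => 0 :=
      funext fun z => (lorentz_comm _ _).trans (hη.1.tangent _)
    have f3 : lorentz (fderiv ℝ (φ ∘ (extChartAt (𝓡 n) x).symm) y v)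
        ((η ∘ (extChartAt (𝓡 n) x).symm) y) = 0 := by
      rw [fderiv_comp_extChartAt_symm hφ.smooth hy, lorentz_comm]
      exact hη.1.normal _ _
    have f4 : fderiv ℝ (lightConeMap φ η ∘ (extChartAt (𝓡 n) x).symm) y =
        fderiv ℝ (φ ∘ (extChartAt (𝓡 n) x).symm) y
          + fderiv ℝ (η ∘ (extChartAt (𝓡 n) x).symm) y := fderiv_add dΦ dH
    rw [f1, lorentz_comm (fderiv ℝ _ y v)] at e1
    rw [f2, f3] at e2
    simp only [fderiv_fun_const, Pi.zero_apply, zero_apply] at e1 e2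
    rw [f4, add_apply, lorentz_add_right]
    linarith
  · rw [injective_iff_map_eq_zero]
    intro v hv
    rw [fderiv_comp_extChartAt_symm hψ hy] at hv
    have h1 := (injective_iff_map_eq_zero _).1 (mvfderiv_lightConeMap_injective hφ hη _) _ hv
    exact (injective_iff_map_eq_zero _).1 (mfderiv_extChartAt_symm_injective hy) _ h1

theorem lorentz_mvfderiv_self (hφ : IsImmersedHypersurface φ) (x : M) (v : TangentSpace (𝓡 n) x) :
    lorentz (φ x) (mvfderiv (𝓡 n) φ x v) = 0 := by
  have d := (hφ.smooth.contDiffOn_comp_extChartAt_symm x).differentiableAt_of_isOpen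
    (isOpen_extChartAt_target x) (mem_extChartAt_target (I := 𝓡 n) x)
  have e := fderiv_lorentz_apply d d (vectorCoord x v)
  have f : (fun z => lorentz ((φ ∘ (extChartAt (𝓡 n) x).symm) z)
      ((φ ∘ (extChartAt (𝓡 n) x).symm) z)) = fun _ => -1 :=
    funext fun z => (hφ.mem_hyperbolicSpace _).1
  rw [f, lorentz_comm (fderiv ℝ _ _ _),
    ← mvfderiv_eq_fderiv_comp_extChartAt_symm hφ.smooth] at e
  simp only [fderiv_fun_const, Pi.zero_apply, zero_apply, Function.comp_apply,
    extChartAt_to_inv] at e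
  linarith

theorem lorentz_mvfderiv_lightConeMap (hφ : IsImmersedHypersurface φ)
    (hη : IsCanonicalOrientation φ η) (x : M) (v : TangentSpace (𝓡 n) x) :
    lorentz (φ x) (mvfderiv (𝓡 n) (lightConeMap φ η) x v) = 0 := by
  have h := (isLightConeImmersion_lightConeMap hφ hη x).normal _
    (mem_extChartAt_target (I := 𝓡 n) x) (vectorCoord x v)
  rw [← mvfderiv_eq_fderiv_comp_extChartAt_symm (contMDiff_lightConeMap hφ hη.1)] at h
  simpa using h

theorem lorentz_lightConeMap_mvfderiv (hφ : IsImmersedHypersurface φ)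
    (hη : IsCanonicalOrientation φ η) (x : M) (v : TangentSpace (𝓡 n) x) :
    lorentz (lightConeMap φ η x) (mvfderiv (𝓡 n) (lightConeMap φ η) x v) = 0 := by
  have h := (isLightConeImmersion_lightConeMap hφ hη x).null_fderiv
    (mem_extChartAt_target (I := 𝓡 n) x) (vectorCoord x v)
  rw [← mvfderiv_eq_fderiv_comp_extChartAt_symm (contMDiff_lightConeMap hφ hη.1)] at h
  simpa using h

/-- The normalized map is `(1, G)`; its differential `(0, dG)` has no time component, so the
Lorentzian product is the Euclidean one. -/
theorem gaussPullback_eq (hφ : IsImmersedHypersurface φ) (hη : IsCanonicalOrientation φ η) (x : M)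
    (v w : TangentSpace (𝓡 n) x) : gaussPullback φ η x v w =
      lorentz (mvfderiv (𝓡 n) (normalizedHeight (lightConeMap φ η)) x v)
        (mvfderiv (𝓡 n) (normalizedHeight (lightConeMap φ η)) x w) := by
  have hN := contMDiff_normalizedHeight_lightConeMap hφ hη.1
  have hL := (isLightConeImmersion_lightConeMap hφ hη x).isLightConeImmersion_normalizedHeight
    fun y _ => lightConeMap_height_pos hφ hη.1 _
  have hx := mem_extChartAt_target (I := 𝓡 n) x
  have hG : ContMDiff (𝓡 n) 𝓘(ℝ, EuclideanSpace ℝ (Fin (n + 1))) ∞ (hyperbolicGaussMap φ η) :=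
    (contDiff_snd (𝕜 := ℝ)).contMDiff.comp hN
  have h1 : ∀ u : TangentSpace (𝓡 n) x,
      (mvfderiv (𝓡 n) (normalizedHeight (lightConeMap φ η)) x u).1 = 0 := fun u => by
    have := hL.normal _ hx (vectorCoord x u)
    rw [lorentz_hyperbolicOrigin] at this
    rw [mvfderiv_eq_fderiv_comp_extChartAt_symm hN]
    exact neg_eq_zero.1 this
  have h2 : ∀ u : TangentSpace (𝓡 n) x, mvfderiv (𝓡 n) (hyperbolicGaussMap φ η) x u =
      (mvfderiv (𝓡 n) (normalizedHeight (lightConeMap φ η)) x u).2 := fun u => by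
    rw [mvfderiv_eq_fderiv_comp_extChartAt_symm hN, mvfderiv_eq_fderiv_comp_extChartAt_symm hG]
    have := fderiv.snd (hL.differentiableAt hx)
    change fderiv ℝ (fun z => (normalizedHeight
      (lightConeMap φ η ∘ (extChartAt (𝓡 n) x).symm) z).2) _ _ = _
    rw [this]
    rfl
  rw [gaussPullback, lorentz, h1, h1, h2, h2]
  simp

/-- The factor `e^{2ρ} = ψ₀²` cancels the conformal factor `ψ₀⁻²` produced by normalizing `ψ`. -/
theorem horosphericalMetric_eq (hφ : IsImmersedHypersurface φ) (hη : IsCanonicalOrientation φ η)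
    (x : M) (v w : TangentSpace (𝓡 n) x) : horosphericalMetric φ η x v w =
      lorentz (mvfderiv (𝓡 n) (lightConeMap φ η) x v)
        (mvfderiv (𝓡 n) (lightConeMap φ η) x w) := by
  have hpos := lightConeMap_height_pos hφ hη.1
  have h1 := (isLightConeImmersion_lightConeMap hφ hη x).lorentz_fderiv_normalizedHeight
    (fun y _ => hpos _) (mem_extChartAt_target (I := 𝓡 n) x) (vectorCoord x v) (vectorCoord x w)
  rw [← mvfderiv_eq_fderiv_comp_extChartAt_symm (contMDiff_lightConeMap hφ hη.1),
    ← mvfderiv_eq_fderiv_comp_extChartAt_symm (contMDiff_lightConeMap hφ hη.1)] at h1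
  have hN := contMDiff_normalizedHeight_lightConeMap hφ hη.1
  rw [horosphericalMetric, gaussPullback_eq hφ hη, mvfderiv_eq_fderiv_comp_extChartAt_symm hN,
    mvfderiv_eq_fderiv_comp_extChartAt_symm hN]
  refine (congrArg _ h1).trans ?_
  have h0 := (hpos x).ne'
  rw [logSupport, two_mul, Real.exp_add, Real.exp_log (hpos x)]
  simp only [Function.comp_apply, extChartAt_to_inv]
  field_simp

theorem metricCoord_horosphericalMetric (hφ : IsImmersedHypersurface φ)
    (hη : IsCanonicalOrientation φ η) (x : M) {y : EuclideanSpace ℝ (Fin n)}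
    (hy : y ∈ (extChartAt (𝓡 n) x).target) : metricCoord (horosphericalMetric φ η) x y =
      gram (lightConeMap φ η ∘ (extChartAt (𝓡 n) x).symm) y := by
  ext i j
  rw [gram_apply, vpartial_comp_extChartAt_symm (contMDiff_lightConeMap hφ hη.1) hy,
    vpartial_comp_extChartAt_symm (contMDiff_lightConeMap hφ hη.1) hy]
  exact horosphericalMetric_eq hφ hη _ _ _

theorem metricCoord_gaussPullback (hφ : IsImmersedHypersurface φ)
    (hη : IsCanonicalOrientation φ η) (x : M) {y : EuclideanSpace ℝ (Fin n)}
    (hy : y ∈ (extChartAt (𝓡 n) x).target) : metricCoord (gaussPullback φ η) x y =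
      gram (normalizedHeight (lightConeMap φ η ∘ (extChartAt (𝓡 n) x).symm)) y := by
  ext i j
  have hN := contMDiff_normalizedHeight_lightConeMap hφ hη.1
  change _ = gram (normalizedHeight (lightConeMap φ η) ∘ (extChartAt (𝓡 n) x).symm) y i j
  rw [gram_apply, vpartial_comp_extChartAt_symm hN hy, vpartial_comp_extChartAt_symm hN hy]
  exact gaussPullback_eq hφ hη _ _ _

/-- The Schouten tensor of the horospherical metric `g` is `½ g - ⟨dφ, dψ⟩`. -/
theorem horosphericalSchouten_eq (hn : 2 ≤ n) (hφ : IsImmersedHypersurface φ)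
    (hη : IsCanonicalOrientation φ η) (x : M) (v w : TangentSpace (𝓡 n) x) :
    horosphericalSchouten φ η x v w = 1 / 2 * horosphericalMetric φ η x v w
      - lorentz (mvfderiv (𝓡 n) (lightConeMap φ η) x v) (mvfderiv (𝓡 n) φ x w) := by
  have hL := isLightConeImmersion_lightConeMap hφ hη x
  have hx := mem_extChartAt_target (I := 𝓡 n) x
  have hU := isOpen_extChartAt_target (I := 𝓡 n) x
  have hψ := contMDiff_lightConeMap hφ hη.1
  have hN := contMDiff_normalizedHeight_lightConeMap hφ hη.1
  have hpos : ∀ y ∈ (extChartAt (𝓡 n) x).target,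
      0 < ((lightConeMap φ η ∘ (extChartAt (𝓡 n) x).symm) y).1 :=
    fun y _ => lightConeMap_height_pos hφ hη.1 _
  have hg : horosphericalMetric φ η x v w = ∑ i, ∑ j,
      gram (lightConeMap φ η ∘ (extChartAt (𝓡 n) x).symm) (extChartAt (𝓡 n) x x) i j
        * vectorCoord x v i * vectorCoord x w j := by
    rw [horosphericalMetric_eq hφ hη, mvfderiv_eq_fderiv_comp_extChartAt_symm hψ,
      mvfderiv_eq_fderiv_comp_extChartAt_symm hψ, lorentz_fderiv_fderiv_eq_sum]
    rfl
  have hR : 1 / 2 * horosphericalMetric φ η x v w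
      - lorentz (mvfderiv (𝓡 n) (lightConeMap φ η) x v) (mvfderiv (𝓡 n) φ x w) =
      ∑ i, ∑ j, (1 / 2 * gram (lightConeMap φ η ∘ (extChartAt (𝓡 n) x).symm)
        (extChartAt (𝓡 n) x x) i j - mixedForm (lightConeMap φ η ∘ (extChartAt (𝓡 n) x).symm)
        (φ ∘ (extChartAt (𝓡 n) x).symm) (extChartAt (𝓡 n) x x) i j)
        * vectorCoord x v i * vectorCoord x w j := by
    rw [hg, mvfderiv_eq_fderiv_comp_extChartAt_symm hψ,
      mvfderiv_eq_fderiv_comp_extChartAt_symm hφ.smooth, lorentz_fderiv_fderiv_eq_sum]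
    simp only [Finset.mul_sum, ← Finset.sum_sub_distrib, mixedForm]
    exact Finset.sum_congr rfl fun i _ => Finset.sum_congr rfl fun j _ => by ring
  rw [hR, horosphericalSchouten]
  -- Both cases reduce to an identity between coefficients: the conformal formula for `n = 2`, the
  -- Gauss equation for `n > 2`.
  split_ifs with h2
  · have hh : gaussPullback φ η x v w = ∑ i, ∑ j,
        gram (normalizedHeight (lightConeMap φ η ∘ (extChartAt (𝓡 n) x).symm))
          (extChartAt (𝓡 n) x x) i j * vectorCoord x v i * vectorCoord x w j := by
      rw [gaussPullback_eq hφ hη, mvfderiv_eq_fderiv_comp_extChartAt_symm hN,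
        mvfderiv_eq_fderiv_comp_extChartAt_symm hN, lorentz_fderiv_fderiv_eq_sum]
      rfl
    have hρ : ContMDiff (𝓡 n) 𝓘(ℝ, ℝ) ∞ (logSupport φ η) := fun z =>
      ((Real.contDiffAt_log.2 (lightConeMap_height_pos hφ hη.1 z).ne').contMDiffAt).comp z
        ((contDiff_fst (𝕜 := ℝ)).contMDiff.comp hψ z)
    have hdρ : ∀ u : TangentSpace (𝓡 n) x, mvfderiv (𝓡 n) (logSupport φ η) x u = ∑ i,
        partialDeriv i (logHeight (lightConeMap φ η ∘ (extChartAt (𝓡 n) x).symm))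
          (extChartAt (𝓡 n) x x) * vectorCoord x u i := fun u => by
      rw [mvfderiv_eq_fderiv_comp_extChartAt_symm hρ, fderiv_eq_sum_vpartial]
      exact Finset.sum_congr rfl fun i _ => mul_comm _ _
    have hH : ∀ i j, hessianCoord (metricCoord (gaussPullback φ η) x)
        (logSupport φ η ∘ (extChartAt (𝓡 n) x).symm) (extChartAt (𝓡 n) x x) i j =
        hessianCoord (gram (normalizedHeight (lightConeMap φ η ∘ (extChartAt (𝓡 n) x).symm)))
          (logHeight (lightConeMap φ η ∘ (extChartAt (𝓡 n) x).symm))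
          (extChartAt (𝓡 n) x x) i j := fun i j => by
      simp only [hessianCoord, christoffel_congr hU
        (fun z hz => metricCoord_gaussPullback hφ hη x hz) hx]
      rfl
    rw [conformalSchoutenTensor, hessianTensor, gradNormSq, hh, hdρ, hdρ,
      metricCoord_gaussPullback hφ hη x hx]
    simp only [hH]
    rw [Finset.sum_mul_sum, ← Finset.sum_neg_distrib, Finset.mul_sum, ← Finset.sum_add_distrib,
      ← Finset.sum_sub_distrib]
    refine Finset.sum_congr rfl fun i _ => ?_
    rw [← Finset.sum_neg_distrib, Finset.mul_sum, ← Finset.sum_add_distrib,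
      ← Finset.sum_sub_distrib]
    refine Finset.sum_congr rfl fun j _ => ?_
    rw [← hL.conformalSchouten_gram hpos hx i j]
    change _ = (_ + _ - 1 / 2 * (-1 + ∑ a, ∑ b, _ * partialDeriv a (logSupport φ η ∘ _) _
      * partialDeriv b (logSupport φ η ∘ _) _) * _) * _ * _
    ring
  · have hn2 : 2 < n := lt_of_le_of_ne hn (Ne.symm h2)
    have hric : ∀ i j, ricciCoord (metricCoord (horosphericalMetric φ η) x)
        (extChartAt (𝓡 n) x x) i j =
        ricciCoord (gram (lightConeMap φ η ∘ (extChartAt (𝓡 n) x).symm))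
          (extChartAt (𝓡 n) x x) i j := fun i j =>
      ricciCoord_congr hU (fun z hz => metricCoord_horosphericalMetric hφ hη x hz) hx i j
    rw [schoutenTensor, ricciTensor, scalarCurvature, hg,
      metricCoord_horosphericalMetric hφ hη x hx]
    simp only [hric]
    rw [Finset.mul_sum, ← Finset.sum_sub_distrib, Finset.mul_sum]
    refine Finset.sum_congr rfl fun i _ => ?_
    rw [Finset.mul_sum, ← Finset.sum_sub_distrib, Finset.mul_sum]
    refine Finset.sum_congr rfl fun j _ => ?_
    rw [← hL.schouten_gram hx hn2 i j]
    ring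

end Hypersurface

/-! ### Principal directions and eigendirections of the Schouten tensor -/

section Directions

variable {n : ℕ} {M : Type*} [TopologicalSpace M] [ChartedSpace (EuclideanSpace ℝ (Fin n)) M]
  {φ η : M → MinkowskiSpace n}

instance finiteDimensional_tangentSpace (x : M) :
    FiniteDimensional ℝ (TangentSpace (𝓡 n) x) :=
  inferInstanceAs (FiniteDimensional ℝ (EuclideanSpace ℝ (Fin n)))

theorem finrank_tangentSpace (x : M) : Module.finrank ℝ (TangentSpace (𝓡 n) x) = n :=
  finrank_euclideanSpace_fin (𝕜 := ℝ) (n := n)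

variable [IsManifold (𝓡 n) ∞ M]

/-- The formula of Rodrigues: `dψ(v) - (1 - k) dφ(v)` is always orthogonal to `φ` and `ψ`, and the
eigenvalue equation says that it is orthogonal to the range of `dφ` too. -/
theorem isPrincipalDirection_iff (hφ : IsImmersedHypersurface φ) (hη : IsCanonicalOrientation φ η)
    {x : M} {k : ℝ} {v : TangentSpace (𝓡 n) x} : IsPrincipalDirection φ η x k v ↔
      v ≠ 0 ∧ mvfderiv (𝓡 n) (lightConeMap φ η) x v = (1 - k) • mvfderiv (𝓡 n) φ x v := by
  refine and_congr_right fun _ => ⟨fun h => ?_, fun h w => ?_⟩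
  · rw [← sub_eq_zero]
    refine eq_zero_of_orthogonal_frame (finrank_tangentSpace x)
      (mvfderiv (𝓡 n) φ x).toLinearMap (hφ.immersion x) (hφ.mem_hyperbolicSpace x).1
      (lorentz_lightConeMap hφ hη.1 x) (lorentz_lightConeMap_self hφ hη.1 x)
      (lorentz_mvfderiv_self hφ x) (fun w => ?_) ?_ ?_ fun w => ?_
    · exact (lorentz_add_left _ _ _).trans ((congrArg₂ (· + ·) (lorentz_mvfderiv_self hφ x w)
        (hη.1.normal x w)).trans (add_zero 0))
    · rw [lorentz_sub_right, lorentz_smul_right, lorentz_mvfderiv_self hφ,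
        lorentz_mvfderiv_lightConeMap hφ hη]
      simp
    · rw [lorentz_sub_right, lorentz_smul_right, lorentz_lightConeMap_mvfderiv hφ hη,
        lightConeMap, lorentz_add_left, lorentz_mvfderiv_self hφ, hη.1.normal]
      simp
    · have h1 := h w
      rw [secondFundamentalForm_comm hφ hη.1, secondFundamentalForm, firstFundamentalForm,
        lorentz_comm (mvfderiv (𝓡 n) φ x v)] at h1
      change lorentz (mvfderiv (𝓡 n) φ x w) _ = 0
      rw [mvfderiv_lightConeMap hφ hη.1, lorentz_sub_right, lorentz_add_right, lorentz_smul_right]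
      linarith
  · have h1 := congrArg (lorentz (mvfderiv (𝓡 n) φ x w)) h
    rw [mvfderiv_lightConeMap hφ hη.1, lorentz_add_right, lorentz_smul_right] at h1
    rw [secondFundamentalForm_comm hφ hη.1, secondFundamentalForm, firstFundamentalForm,
      lorentz_comm (mvfderiv (𝓡 n) φ x v)]
    linarith

/-- The form is the difference of the first and the second fundamental form, both symmetric. -/
theorem lorentz_mvfderiv_lightConeMap_comm (hφ : IsImmersedHypersurface φ)
    (hη : IsUnitNormal φ η) (x : M) (v w : TangentSpace (𝓡 n) x) :
    lorentz (mvfderiv (𝓡 n) (lightConeMap φ η) x v) (mvfderiv (𝓡 n) φ x w) =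
      lorentz (mvfderiv (𝓡 n) (lightConeMap φ η) x w) (mvfderiv (𝓡 n) φ x v) := by
  have h := secondFundamentalForm_comm hφ hη x v w
  simp only [secondFundamentalForm, neg_inj] at h
  rw [mvfderiv_lightConeMap hφ hη, mvfderiv_lightConeMap hφ hη, lorentz_add_left,
    lorentz_add_left, lorentz_comm (mvfderiv (𝓡 n) η x v), lorentz_comm (mvfderiv (𝓡 n) η x w), h,
    lorentz_comm (mvfderiv (𝓡 n) φ x v)]

/-- Since `Sch_g = ½ g - ⟨dψ, dφ⟩`, the eigenvalue equation says that `dφ(v) - (½ - l) dψ(v)` is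
orthogonal to the range of `dψ`; orthogonality to `φ` and `ψ` is automatic. -/
theorem isSchoutenEigendirection_iff (hn : 2 ≤ n) (hφ : IsImmersedHypersurface φ)
    (hη : IsCanonicalOrientation φ η) {x : M} {l : ℝ} {v : TangentSpace (𝓡 n) x} :
    IsSchoutenEigendirection φ η x l v ↔
      v ≠ 0 ∧ mvfderiv (𝓡 n) φ x v = (1 / 2 - l) • mvfderiv (𝓡 n) (lightConeMap φ η) x v := by
  refine and_congr_right fun _ => ⟨fun h => ?_, fun h w => ?_⟩
  · rw [← sub_eq_zero]
    refine eq_zero_of_orthogonal_frame (finrank_tangentSpace x)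
      (mvfderiv (𝓡 n) (lightConeMap φ η) x).toLinearMap (mvfderiv_lightConeMap_injective hφ hη x)
      (hφ.mem_hyperbolicSpace x).1
      (lorentz_lightConeMap hφ hη.1 x) (lorentz_lightConeMap_self hφ hη.1 x)
      (lorentz_mvfderiv_lightConeMap hφ hη x) (lorentz_lightConeMap_mvfderiv hφ hη x)
      ?_ ?_ fun w => ?_
    · rw [lorentz_sub_right, lorentz_smul_right, lorentz_mvfderiv_self hφ,
        lorentz_mvfderiv_lightConeMap hφ hη]
      simp
    · rw [lorentz_sub_right, lorentz_smul_right, lorentz_lightConeMap_mvfderiv hφ hη,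
        lightConeMap, lorentz_add_left, lorentz_mvfderiv_self hφ, hη.1.normal]
      simp
    · have h1 := h w
      rw [horosphericalSchouten_eq hn hφ hη, horosphericalMetric_eq hφ hη,
        lorentz_mvfderiv_lightConeMap_comm hφ hη.1,
        lorentz_comm (mvfderiv (𝓡 n) (lightConeMap φ η) x v)] at h1
      change lorentz (mvfderiv (𝓡 n) (lightConeMap φ η) x w) _ = 0
      rw [lorentz_sub_right, lorentz_smul_right]
      linarith
  · have h1 := congrArg (lorentz (mvfderiv (𝓡 n) (lightConeMap φ η) x w)) h
    rw [lorentz_smul_right] at h1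
    rw [horosphericalSchouten_eq hn hφ hη, horosphericalMetric_eq hφ hη,
      lorentz_mvfderiv_lightConeMap_comm hφ hη.1,
      lorentz_comm (mvfderiv (𝓡 n) (lightConeMap φ η) x v), h1]
    ring

theorem IsPrincipalDirection.isSchoutenEigendirection (hn : 2 ≤ n) (hφ : IsImmersedHypersurface φ)
    (hη : IsCanonicalOrientation φ η) {x : M} {k : ℝ} {v : TangentSpace (𝓡 n) x}
    (h : IsPrincipalDirection φ η x k v) :
    IsSchoutenEigendirection φ η x (1 / 2 - 1 / (1 - k)) v := by
  have hk : 1 - k ≠ 0 := (sub_pos.2 (hη.2 x k v h)).ne'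
  rw [isPrincipalDirection_iff hφ hη] at h
  rw [isSchoutenEigendirection_iff hn hφ hη, h.2, smul_smul]
  refine ⟨h.1, ?_⟩
  rw [sub_sub_cancel, one_div, inv_mul_cancel₀ hk, one_smul]

theorem IsSchoutenEigendirection.isPrincipalDirection (hn : 2 ≤ n) (hφ : IsImmersedHypersurface φ)
    (hη : IsCanonicalOrientation φ η) {x : M} {l : ℝ} {v : TangentSpace (𝓡 n) x}
    (h : IsSchoutenEigendirection φ η x l v) :
    IsPrincipalDirection φ η x (1 - (1 / 2 - l)⁻¹) v := by
  rw [isSchoutenEigendirection_iff hn hφ hη] at h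
  -- The eigenvalue `½` is excluded because it would force `dφ(v) = 0`.
  have hl : 1 / 2 - l ≠ 0 := fun h0 => by
    rw [h0, zero_smul] at h
    exact h.1 (hφ.immersion x (by rw [h.2, map_zero]))
  rw [isPrincipalDirection_iff hφ hη, h.2, smul_smul]
  refine ⟨h.1, ?_⟩
  rw [sub_sub_cancel, inv_mul_cancel₀ hl, one_smul]

/-- Substituting one vector equation into the other gives `dφ(v) = (½ - l)(1 - k) dφ(v)` with `dφ(v)
≠ 0`. -/
theorem principalCurvature_schoutenEigenvalue (hn : 2 ≤ n) (hφ : IsImmersedHypersurface φ)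
    (hη : IsCanonicalOrientation φ η) {x : M} {k l : ℝ} {v : TangentSpace (𝓡 n) x}
    (hk : IsPrincipalDirection φ η x k v) (hl : IsSchoutenEigendirection φ η x l v) :
    l = 1 / 2 - 1 / (1 - k) := by
  have hk1 : 1 - k ≠ 0 := (sub_pos.2 (hη.2 x k v hk)).ne'
  rw [isPrincipalDirection_iff hφ hη] at hk
  rw [isSchoutenEigendirection_iff hn hφ hη, hk.2, smul_smul] at hl
  have h0 : mvfderiv (𝓡 n) φ x v ≠ 0 := fun h => hk.1 (hφ.immersion x (by rw [h, map_zero]))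
  have h1 : (1 / 2 - l) * (1 - k) = 1 := by
    have : (1 - (1 / 2 - l) * (1 - k)) • mvfderiv (𝓡 n) φ x v = 0 := by
      rw [sub_smul, one_smul, ← hl.2, sub_self]
    linarith [(smul_eq_zero.1 this).resolve_right h0]
  have := eq_div_of_mul_eq hk1 h1
  linarith

theorem curvatureRadius_formulas {k l : ℝ} (hk : k < 1) (h : l = 1 / 2 - 1 / (1 - k)) :
    hyperbolicCurvatureRadius k = 1 / (1 - k) ∧ 1 / (1 - k) = 1 / 2 - l ∧
      2 * l = (k + 1) / (k - 1) := by
  have h1 : 1 - k ≠ 0 := (sub_pos.2 hk).ne'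
  have h2 : k - 1 ≠ 0 := (sub_neg.2 hk).ne
  refine ⟨by rw [hyperbolicCurvatureRadius, abs_of_pos (sub_pos.2 hk)], by rw [h]; ring, ?_⟩
  rw [h, ← neg_sub k 1]
  field_simp
  ring

/-- The bilinear form `⟨dα, dβ⟩` on a tangent space. -/
def pullbackForm (α β : M → MinkowskiSpace n) (x : M) :
    LinearMap.BilinForm ℝ (TangentSpace (𝓡 n) x) :=
  (lorentzForm n).compl₁₂ (mvfderiv (𝓡 n) α x).toLinearMap (mvfderiv (𝓡 n) β x).toLinearMap

/-- The first fundamental form is positive definite because `dφ` is injective with values orthogonal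
to the timelike `φ`. -/
theorem exists_arePrincipalCurvatures (hφ : IsImmersedHypersurface φ) (hη : IsUnitNormal φ η)
    (x : M) : ∃ κ : Fin n → ℝ, ArePrincipalCurvatures φ η x κ :=
  exists_areEigenvalues (pullbackForm φ φ x) (-pullbackForm φ η x) (finrank_tangentSpace x)
    (fun _ _ => lorentz_comm _ _) (secondFundamentalForm_comm hφ hη x) fun v hv =>
      lorentz_self_pos_of_orthogonal (by rw [(hφ.mem_hyperbolicSpace x).1]; norm_num)
        (lorentz_mvfderiv_self hφ x v)
        fun h => hv (hφ.immersion x (h.trans (map_zero _).symm))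

theorem ArePrincipalCurvatures.areSchoutenEigenvalues (hn : 2 ≤ n) (hφ : IsImmersedHypersurface φ)
    (hη : IsCanonicalOrientation φ η) {x : M} {κ : Fin n → ℝ}
    (h : ArePrincipalCurvatures φ η x κ) : (∀ i, κ i < 1) ∧
      AreSchoutenEigenvalues φ η x fun i => 1 / 2 - 1 / (1 - κ i) := by
  obtain ⟨v, hv⟩ := h
  have hp : ∀ i, IsPrincipalDirection φ η x (κ i) (v i) :=
    isEigendirection_of_diagonal (A := pullbackForm φ φ x) (B := -pullbackForm φ η x)
      (finrank_tangentSpace x) hv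
  have hκ : ∀ i, κ i < 1 := fun i => hη.2 x _ _ (hp i)
  have hψ := fun i => ((isPrincipalDirection_iff hφ hη).1 (hp i)).2
  have hg : ∀ i j, horosphericalMetric φ η x (v i) (v j) =
      if i = j then (1 - κ i) ^ 2 else 0 := fun i j => by
    rw [horosphericalMetric_eq hφ hη, hψ, hψ, lorentz_smul_left, lorentz_smul_right]
    have := (hv i j).1
    rw [firstFundamentalForm] at this
    rw [this]
    split_ifs with hij
    · rw [hij]; ring
    · ring
  have hS : ∀ i j, horosphericalSchouten φ η x (v i) (v j) =
      (1 / 2 - 1 / (1 - κ i)) * horosphericalMetric φ η x (v i) (v j) := fun i j =>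
    ((hp i).isSchoutenEigendirection hn hφ hη).2 (v j)
  have hgs : ∀ (a b : ℝ) (u w : TangentSpace (𝓡 n) x),
      horosphericalMetric φ η x (a • u) (b • w) = a * b * horosphericalMetric φ η x u w :=
    fun a b u w => by
      simp only [horosphericalMetric_eq hφ hη, map_smul, lorentz_smul_left, lorentz_smul_right]
      ring
  have hSs : ∀ (a b : ℝ) (u w : TangentSpace (𝓡 n) x),
      horosphericalSchouten φ η x (a • u) (b • w) = a * b * horosphericalSchouten φ η x u w :=
    fun a b u w => by
      simp only [horosphericalSchouten_eq hn hφ hη, hgs, map_smul, lorentz_smul_left,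
        lorentz_smul_right]
      ring
  -- The principal frame is `g`-orthogonal with `g(vᵢ, vᵢ) = (1 - κᵢ)²`, whence the rescaling.
  refine ⟨hκ, fun i => (1 - κ i)⁻¹ • v i, fun i j => ?_⟩
  have h0 : 1 - κ i ≠ 0 := (sub_pos.2 (hκ i)).ne'
  rw [hgs, hSs, hS, hg]
  by_cases hij : i = j
  · subst hij
    simp only [if_true]
    constructor <;> field_simp
  · simp [hij]

/-- The metric and Schouten tensor are defined as mere functions of two vectors; their expressions
through `dψ` and `dφ` exhibit them as bilinear forms, to which the general uniqueness applies. -/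
theorem AreSchoutenEigenvalues.exists_perm (hn : 2 ≤ n) (hφ : IsImmersedHypersurface φ)
    (hη : IsCanonicalOrientation φ η) {x : M} {μ ν : Fin n → ℝ}
    (hμ : AreSchoutenEigenvalues φ η x μ) (hν : AreSchoutenEigenvalues φ η x ν) :
    ∃ σ : Equiv.Perm (Fin n), ∀ i, μ i = ν (σ i) := by
  let g := pullbackForm (lightConeMap φ η) (lightConeMap φ η) x
  let S := (1 / 2 : ℝ) • g - pullbackForm (lightConeMap φ η) φ x
  have hg : horosphericalMetric φ η x = fun v w => g v w :=
    funext fun v => funext fun w => horosphericalMetric_eq hφ hη x v w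
  have hS : horosphericalSchouten φ η x = fun v w => S v w :=
    funext fun v => funext fun w => by
      rw [horosphericalSchouten_eq hn hφ hη, horosphericalMetric_eq hφ hη]
      rfl
  rw [AreSchoutenEigenvalues, hg, hS] at hμ hν
  exact AreEigenvalues.exists_perm (finrank_tangentSpace x) hμ hν

end Directions

end

/-- On a canonically oriented horospherical ovaloid `φ : 𝕊ⁿ → ℍ^{n+1}`, at every point: the
principal curvatures `κᵢ` and the eigenvalues `lamᵢ` of the Schouten tensor of the horospherical
metric exist, and in a suitable order `𝓡ᵢ = 1 / (1 - κᵢ) = ½ - lamᵢ` and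
`2 lamᵢ = (κᵢ + 1) / (κᵢ - 1)`; moreover the eigendirections of the Schouten tensor are the principal
directions, and the eigenvalues that belong to a common direction correspond in this way. -/
theorem mainTheorem4 {n : ℕ} (hn : 2 ≤ n)
    (φ η : Metric.sphere (0 : EuclideanSpace ℝ (Fin (n + 1))) 1 → MinkowskiSpace n)
    (hφ : IsHorosphericalOvaloid φ) (hη : IsCanonicalOrientation φ η)
    (x : Metric.sphere (0 : EuclideanSpace ℝ (Fin (n + 1))) 1) :
    (∃ κ : Fin n → ℝ, ArePrincipalCurvatures φ η x κ) ∧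
    (∃ lam : Fin n → ℝ, AreSchoutenEigenvalues φ η x lam) ∧
    (∀ κ lam : Fin n → ℝ, ArePrincipalCurvatures φ η x κ → AreSchoutenEigenvalues φ η x lam →
      ∃ σ : Equiv.Perm (Fin n), ∀ i,
        hyperbolicCurvatureRadius (κ i) = 1 / (1 - κ i) ∧
        1 / (1 - κ i) = 1 / 2 - lam (σ i) ∧
        2 * lam (σ i) = (κ i + 1) / (κ i - 1)) ∧
    (∀ v : TangentSpace (𝓡 n) x,
      (∃ k, IsPrincipalDirection φ η x k v) ↔ (∃ l, IsSchoutenEigendirection φ η x l v)) ∧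
    (∀ (v : TangentSpace (𝓡 n) x) (k l : ℝ), IsPrincipalDirection φ η x k v →
      IsSchoutenEigendirection φ η x l v →
        hyperbolicCurvatureRadius k = 1 / (1 - k) ∧
        1 / (1 - k) = 1 / 2 - l ∧
        2 * l = (k + 1) / (k - 1)) := by
  have hi := hφ.2.1
  refine ⟨exists_arePrincipalCurvatures hi hη.1 x, ?_, ?_, ?_, ?_⟩
  · obtain ⟨κ, hκ⟩ := exists_arePrincipalCurvatures hi hη.1 x
    exact ⟨_, (hκ.areSchoutenEigenvalues hn hi hη).2⟩
  · intro κ lam hκ hlam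
    obtain ⟨h1, hS⟩ := hκ.areSchoutenEigenvalues hn hi hη
    -- The values `½ - 1 / (1 - κᵢ)` form one eigenvalue family, and `lam` is another; `σ` matches
    -- the two.
    obtain ⟨σ, hσ⟩ := hS.exists_perm hn hi hη hlam
    exact ⟨σ, fun i => curvatureRadius_formulas (h1 i) (hσ i).symm⟩
  · exact fun v => ⟨fun ⟨_, h⟩ => ⟨_, h.isSchoutenEigendirection hn hi hη⟩,
      fun ⟨_, h⟩ => ⟨_, h.isPrincipalDirection hn hi hη⟩⟩
  · exact fun v k l hk hl => curvatureRadius_formulas (hη.2 x k v hk)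
      (principalCurvature_schoutenEigenvalue hn hi hη hk hl)
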